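/- Let $M$, $E$, $F$ be smooth manifolds of dimensions $n$, $n+k$, $k$, and let $\pi:E\to M$ be a smooth fiber bundle with typical fiber $F$. Let $$J^1\pi=\{\tau_e : T_{\pi(e)}M\to T_eE \text{ linear} : e\in E,\ \pi_*(e)\circ\tau_e=\mathrm{id}\}$$ be the first jet bundle of $\pi$, and let $$L_\pi E=\{(e_i,e_A)_e : e\in E,\ (e_1,\dots,e_n,e_{n+1},\dots,e_{n+k}) \text{ is a basis of } T_eE,\ \pi_*(e)(e_A)=0\}$$ be the adapted frame bundle, where $1\le i\le n$ and $A$ runs over the last $k$ indices. Adapted coordinates $(x^i,y^A)$ on an open set $U\subseteq E$ are coordinates such that the $x^i$ are pulled back by $\pi$ from coordinates on an open subset of $M$. They induce the coordinates $(x^i,y^A,y^A_j)$ on the part of $J^1\pi$ over $U$, where $y^A_j(\tau_e)=dy^A(\tau_e(\partial/\partial x^j))$, and the coordinates $(x^i,y^A,v^i_j,v^A_j,v^A_B)$ on the part of $L_\pi E$ over $U$, where $v^i_j=dx^i(e_j)$, $v^A_j=dy^A(e_j)$, $v^A_B=dy^A(e_B)$; these coordinates define the smooth structures of $J^1\pi$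 and $L_\pi E$. Let the Lie group $H=GL(n,\mathbb R)\times GL(k,\mathbb R)$ act on $L_\pi E$ on the right by $(e_i,e_A)_e\cdot(a,b)=(a^i_j e_i,\ b^B_A e_B)_e$, and let $$\rho:L_\pi E\to J^1\pi,\qquad (e_i,e_A)_e\mapsto \tau_e,\quad \tau_e(\pi_*(e)(e_i))=e_i .$$ This map is well defined, since the vectors $\pi_*(e)(e_i)$ form a basis of $T_{\pi(e)}M$. Then: 1. $\rho:L_\pi E\to J^1\pi$ is a smooth principal fiber bundle with structure group $H$: the action of $H$ is smooth and free, its orbits are exactly the fibers of the smooth surjection $\rho$, and $\rho$ has smooth $H$-equivariant local trivializations around every point of $J^1\pi$. 2. For all adapted coordinates $(x^i,y^A)$ on $U\subseteq E$, the Lagrangian coordinates $u^A_j=\sum_i v^A_i\,\pi^i_j$ on the part of $L_\pi E$ over $U$, where $\pi^i_j(e_i,e_A)_e=e^i(\partial/\partial x^j)$ and $(e^i,e^A)$ is the dual frame, are the pull-backs of the jet coordinates: $u^A_j=y^A_j\circ\rho$. -/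

import Mathlib

open scoped Manifold ContDiff Topology
open Set

noncomputable section

namespace JetFrame

/-- The coordinate space `ℝ^d`. -/
abbrev Euc (d : ℕ) := EuclideanSpace ℝ (Fin d)

/-- The `j`-th standard basis vector of `ℝ^d`. -/
abbrev stdVec {d : ℕ} (j : Fin d) : Euc d := EuclideanSpace.single j (1 : ℝ)

/-- The Lie group `GL(d, ℝ)`: invertible linear endomorphisms of `ℝ^d`, with Mathlib's Lie group
structure. The matrix of `A` has entries `A^i_j = A (stdVec j) i`. -/
abbrev GLd (d : ℕ) := (Euc d →L[ℝ] Euc d)ˣ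

/-- The structure group `H = GL(n) × GL(k)` (block diagonal invertible matrices). -/
abbrev StructureGroup (n k : ℕ) := GLd n × GLd k

/-- The model space of `GL(n) × GL(k)`. -/
abbrev GroupModel (n k : ℕ) := ModelProd (Euc n →L[ℝ] Euc n) (Euc k →L[ℝ] Euc k)

instance (d : ℕ) : ChartedSpace (Euc d →L[ℝ] Euc d) (GLd d) := Units.instChartedSpace

instance (d : ℕ) : LieGroup 𝓘(ℝ, Euc d →L[ℝ] Euc d) ∞ (GLd d) :=
  Units.instLieGroupModelWithCornersSelf

instance (n k : ℕ) : ChartedSpace (GroupModel n k) (StructureGroup n k) := prodChartedSpace _ _ _ _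

instance (n k : ℕ) :
    LieGroup (𝓘(ℝ, Euc n →L[ℝ] Euc n).prod 𝓘(ℝ, Euc k →L[ℝ] Euc k)) ∞ (StructureGroup n k) :=
  Prod.instLieGroup

/-- A smooth fiber bundle `π : E → M` with typical fiber `F`, where `dim M = n`,
`dim E = n + k` and `dim F = k`: over a neighbourhood of every point of `M` there is a
diffeomorphism of the preimage with the product of that neighbourhood and `F`, over `M`. -/
structure SmoothFiberBundle (n k : ℕ) (F E M : Type*)
    [TopologicalSpace F] [ChartedSpace (Euc k) F]
    [TopologicalSpace E] [ChartedSpace (Euc (n + k)) E]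
    [TopologicalSpace M] [ChartedSpace (Euc n) M] where
  proj : E → M
  locally_trivial : ∀ x : M, ∃ t : Bundle.Trivialization F proj, x ∈ t.baseSet ∧
    ContMDiffOn (𝓡 (n + k)) ((𝓡 n).prod (𝓡 k)) ∞ t t.source ∧
    ContMDiffOn ((𝓡 n).prod (𝓡 k)) (𝓡 (n + k)) ∞ t.toOpenPartialHomeomorph.symm t.target

/-- Smooth principal bundles. `ρ : P → B` is a principal bundle with structure group the Lie group
`G`, which acts on `P` on the right (an action of `Gᵐᵒᵖ`; `p · g` is `MulOpposite.op g • p`):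
the action is smooth and free, its orbits are the fibers of the smooth surjection `ρ`, and near
every point of `B` there is a smooth `G`-equivariant local trivialization. -/
structure IsSmoothPrincipalBundle
    {VP HP VB HB VG HG : Type*}
    [NormedAddCommGroup VP] [NormedSpace ℝ VP] [TopologicalSpace HP]
    [NormedAddCommGroup VB] [NormedSpace ℝ VB] [TopologicalSpace HB]
    [NormedAddCommGroup VG] [NormedSpace ℝ VG] [TopologicalSpace HG]
    (IP : ModelWithCorners ℝ VP HP) (IB : ModelWithCorners ℝ VB HB)
    (IG : ModelWithCorners ℝ VG HG)
    {P B : Type*} (G : Type*)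
    [TopologicalSpace P] [ChartedSpace HP P] [IsManifold IP ∞ P]
    [TopologicalSpace B] [ChartedSpace HB B] [IsManifold IB ∞ B]
    [TopologicalSpace G] [ChartedSpace HG G] [Group G] [LieGroup IG ∞ G]
    [MulAction (MulOpposite G) P] (ρ : P → B) : Prop where
  contMDiff_act : ContMDiff (IP.prod IG) IP ∞ (fun q : P × G => MulOpposite.op q.2 • q.1)
  free : ∀ (p : P) (g : G), MulOpposite.op g • p = p → g = 1
  orbits : ∀ p q : P, ρ p = ρ q ↔ ∃ g : G, MulOpposite.op g • p = q
  surjective : Function.Surjective ρ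
  contMDiff_proj : ContMDiff IP IB ∞ ρ
  locally_trivial : ∀ b : B, ∃ t : Bundle.Trivialization G ρ, b ∈ t.baseSet ∧
    ContMDiffOn IP (IB.prod IG) ∞ t t.source ∧
    ContMDiffOn (IB.prod IG) IP ∞ t.toOpenPartialHomeomorph.symm t.target ∧
    ∀ p ∈ t.source, ∀ g : G, t (MulOpposite.op g • p) = ((t p).1, (t p).2 * g)

variable {n k : ℕ} {F E M : Type*}
  [TopologicalSpace F] [ChartedSpace (Euc k) F]
  [TopologicalSpace E] [ChartedSpace (Euc (n + k)) E]
  [TopologicalSpace M] [ChartedSpace (Euc n) M]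

instance (e : E) : FiniteDimensional ℝ (TangentSpace (𝓡 (n + k)) e) :=
  inferInstanceAs (FiniteDimensional ℝ (Euc (n + k)))

instance (x : M) : FiniteDimensional ℝ (TangentSpace (𝓡 n) x) :=
  inferInstanceAs (FiniteDimensional ℝ (Euc n))

instance (x : M) : T2Space (TangentSpace (𝓡 n) x) :=
  inferInstanceAs (T2Space (Euc n))

/-- The tangent map `π_*(e) : T_e E → T_{π(e)} M`. -/
abbrev SmoothFiberBundle.tangentMap (π : SmoothFiberBundle n k F E M) (e : E) :
    TangentSpace (𝓡 (n + k)) e →L[ℝ] TangentSpace (𝓡 n) (π.proj e) :=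
  mfderiv (𝓡 (n + k)) (𝓡 n) π.proj e

/-- The first jet bundle `J¹π`: pairs of a point `e ∈ E` and a linear right inverse
`τ_e : T_{π(e)} M → T_e E` of `π_*(e)`. -/
structure JetBundle (π : SmoothFiberBundle n k F E M) where
  point : E
  lift : TangentSpace (𝓡 n) (π.proj point) →L[ℝ] TangentSpace (𝓡 (n + k)) point
  tangentMap_comp_lift : (π.tangentMap point).comp lift = ContinuousLinearMap.id ℝ _

/-- The adapted frame bundle `L_π E`: bases `(e_i, e_A)` of tangent spaces `T_e E` whose last `k`
vectors are vertical. The vector `e_i` is `basis (Sum.inl i)`, and `e_A` is `basis (Sum.inr A)`. -/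
structure AdaptedFrame (π : SmoothFiberBundle n k F E M) where
  point : E
  basis : Module.Basis (Fin n ⊕ Fin k) ℝ (TangentSpace (𝓡 (n + k)) point)
  vertical : ∀ A : Fin k, π.tangentMap point (basis (Sum.inr A)) = 0

lemma JetBundle.ext_lift {π : SmoothFiberBundle n k F E M} {e : E}
    {τ τ' : TangentSpace (𝓡 n) (π.proj e) →L[ℝ] TangentSpace (𝓡 (n + k)) e}
    {h : (π.tangentMap e).comp τ = ContinuousLinearMap.id ℝ _}
    {h' : (π.tangentMap e).comp τ' = ContinuousLinearMap.id ℝ _} (hτ : τ = τ') :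
    JetBundle.mk e τ h = JetBundle.mk e τ' h' := by
  subst hτ; rfl

lemma AdaptedFrame.ext_basis {π : SmoothFiberBundle n k F E M} {e : E}
    {b b' : Module.Basis (Fin n ⊕ Fin k) ℝ (TangentSpace (𝓡 (n + k)) e)}
    {h : ∀ A : Fin k, π.tangentMap e (b (Sum.inr A)) = 0}
    {h' : ∀ A : Fin k, π.tangentMap e (b' (Sum.inr A)) = 0} (hb : ∀ i, b i = b' i) :
    AdaptedFrame.mk e b h = AdaptedFrame.mk e b' h' := by
  obtain rfl : b = b' := Module.Basis.eq_of_apply_eq hb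
  rfl

/-- Adapted coordinates `(x^i, y^A)` on the open set `total.source ⊆ E`, lying over the coordinates
`x^i` on the open set `base.source ⊆ M`. -/
structure AdaptedChart (π : SmoothFiberBundle n k F E M) where
  total : OpenPartialHomeomorph E (Euc n × Euc k)
  base : OpenPartialHomeomorph M (Euc n)
  contMDiffOn_total : ContMDiffOn (𝓡 (n + k)) 𝓘(ℝ, Euc n × Euc k) ∞ total total.source
  contMDiffOn_total_symm :
    ContMDiffOn 𝓘(ℝ, Euc n × Euc k) (𝓡 (n + k)) ∞ total.symm total.target
  contMDiffOn_base : ContMDiffOn (𝓡 n) 𝓘(ℝ, Euc n) ∞ base base.source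
  contMDiffOn_base_symm : ContMDiffOn 𝓘(ℝ, Euc n) (𝓡 n) ∞ base.symm base.target
  mapsTo_proj : ∀ e ∈ total.source, π.proj e ∈ base.source
  fst_total : ∀ e ∈ total.source, (total e).1 = base (π.proj e)

/-! ### Existence of adapted coordinates -/

lemma SmoothFiberBundle.contMDiff_proj (π : SmoothFiberBundle n k F E M) :
    ContMDiff (𝓡 (n + k)) (𝓡 n) ∞ π.proj := by
  intro e
  obtain ⟨t, ht, h1, -⟩ := π.locally_trivial (π.proj e)
  have hes : e ∈ t.source := t.mem_source.2 ht
  have h2 := (h1 e hes).contMDiffAt (t.open_source.mem_nhds hes)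
  refine (contMDiff_fst.contMDiffAt.comp e h2).congr_of_eventuallyEq ?_
  filter_upwards [t.open_source.mem_nhds hes] with y hy
  exact (t.proj_toFun y hy).symm

lemma SmoothFiberBundle.exists_adaptedChart [IsManifold (𝓡 k) ∞ F] [IsManifold (𝓡 n) ∞ M]
    (π : SmoothFiberBundle n k F E M) (e : E) :
    ∃ c : AdaptedChart π, e ∈ c.total.source := by
  obtain ⟨t, ht, h1, h2⟩ := π.locally_trivial (π.proj e)
  have hes : e ∈ t.source := t.mem_source.2 ht
  set ψ := chartAt (Euc n) (π.proj e)
  set χ := chartAt (Euc k) (t e).2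
  have hψ : ContMDiffOn (𝓡 n) 𝓘(ℝ, Euc n) ∞ ψ ψ.source := contMDiffOn_chart
  have hψ' : ContMDiffOn 𝓘(ℝ, Euc n) (𝓡 n) ∞ ψ.symm ψ.target := contMDiffOn_chart_symm
  have hχ : ContMDiffOn (𝓡 k) 𝓘(ℝ, Euc k) ∞ χ χ.source := contMDiffOn_chart
  have hχ' : ContMDiffOn 𝓘(ℝ, Euc k) (𝓡 k) ∞ χ.symm χ.target := contMDiffOn_chart_symm
  refine ⟨⟨t.toOpenPartialHomeomorph.trans (ψ.prod χ), ψ, ?_, ?_, hψ, hψ', ?_, ?_⟩, ?_⟩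
  · have hs : (t.toOpenPartialHomeomorph.trans (ψ.prod χ)).source ⊆ t.source := by
      intro y hy; simp only [OpenPartialHomeomorph.trans_source] at hy; exact hy.1
    have hm : ∀ y ∈ (t.toOpenPartialHomeomorph.trans (ψ.prod χ)).source,
        (t y).1 ∈ ψ.source ∧ (t y).2 ∈ χ.source := by
      intro y hy; simpa using hy.2
    refine ContMDiffOn.prodMk_space (f := fun y => ψ (t y).1) (g := fun y => χ (t y).2) ?_ ?_
    · exact hψ.comp (contMDiff_fst.comp_contMDiffOn (h1.mono hs)) (fun y hy => (hm y hy).1)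
    · exact hχ.comp (contMDiff_snd.comp_contMDiffOn (h1.mono hs)) (fun y hy => (hm y hy).2)
  · have hm : ∀ z ∈ (t.toOpenPartialHomeomorph.trans (ψ.prod χ)).target,
        z.1 ∈ ψ.target ∧ z.2 ∈ χ.target ∧ (ψ.symm z.1, χ.symm z.2) ∈ t.target := by
      intro z hz
      simp only [OpenPartialHomeomorph.trans_target, OpenPartialHomeomorph.prod_target,
        mem_inter_iff, mem_prod] at hz
      exact ⟨hz.1.1, hz.1.2, hz.2⟩
    have key : ContMDiffOn 𝓘(ℝ, Euc n × Euc k) ((𝓡 n).prod (𝓡 k)) ∞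
        (fun z : Euc n × Euc k => (ψ.symm z.1, χ.symm z.2))
        (t.toOpenPartialHomeomorph.trans (ψ.prod χ)).target := by
      refine ContMDiffOn.prodMk ?_ ?_
      · exact hψ'.comp contDiff_fst.contMDiff.contMDiffOn (fun z hz => (hm z hz).1)
      · exact hχ'.comp contDiff_snd.contMDiff.contMDiffOn (fun z hz => (hm z hz).2.1)
    exact h2.comp key (fun z hz => (hm z hz).2.2)
  · intro y hy
    have hy2 : (t y).1 ∈ ψ.source := by
      have := hy.2; simp at this; exact this.1
    have : y ∈ t.source := by
      simp only [OpenPartialHomeomorph.trans_source] at hy; exact hy.1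
    have h3 : (t y).1 = π.proj y := t.proj_toFun y this
    rwa [h3] at hy2
  · intro y hy
    have : y ∈ t.source := by
      simp only [OpenPartialHomeomorph.trans_source] at hy; exact hy.1
    have h3 : (t y).1 = π.proj y := t.proj_toFun y this
    change ψ (t y).1 = _
    rw [h3]
  · have h3 : (t e).1 = π.proj e := t.proj_toFun e hes
    simp only [OpenPartialHomeomorph.trans_source, mem_inter_iff, mem_preimage,
      OpenPartialHomeomorph.prod_source, mem_prod]
    refine ⟨hes, ?_, mem_chart_source _ _⟩
    change (t e).1 ∈ ψ.source
    rw [h3]; exact mem_chart_source _ _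

namespace AdaptedChart

variable {π : SmoothFiberBundle n k F E M} (c c' : AdaptedChart π)

/-- The differential `(dx^i, dy^A)` of the coordinates at `e`. -/
def dTotal (e : E) : TangentSpace (𝓡 (n + k)) e →L[ℝ] Euc n × Euc k :=
  mfderiv (𝓡 (n + k)) 𝓘(ℝ, Euc n × Euc k) c.total e

/-- The differential `(dx^i)` of the coordinates of the base at `x`. -/
def dBase (x : M) : TangentSpace (𝓡 n) x →L[ℝ] Euc n :=
  mfderiv (𝓡 n) 𝓘(ℝ, Euc n) c.base x

/-- The coordinate vector `∂/∂x^j` at `e ∈ E`. -/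
def ddxTotal (e : E) (j : Fin n) : TangentSpace (𝓡 (n + k)) e :=
  (c.dTotal e).inverse (stdVec j, 0)

/-- The coordinate vector `∂/∂x^j` at `x ∈ M`. -/
def ddxBase (x : M) (j : Fin n) : TangentSpace (𝓡 n) x :=
  (c.dBase x).inverse (stdVec j)

lemma mdiff_total : c.total.MDifferentiable (𝓡 (n + k)) 𝓘(ℝ, Euc n × Euc k) :=
  ⟨c.contMDiffOn_total.mdifferentiableOn (by simp),
    c.contMDiffOn_total_symm.mdifferentiableOn (by simp)⟩

lemma mdiff_base : c.base.MDifferentiable (𝓡 n) 𝓘(ℝ, Euc n) :=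
  ⟨c.contMDiffOn_base.mdifferentiableOn (by simp),
    c.contMDiffOn_base_symm.mdifferentiableOn (by simp)⟩

lemma exists_dTotal_equiv {e : E} (he : e ∈ c.total.source) :
    ∃ L : TangentSpace (𝓡 (n + k)) e ≃L[ℝ] Euc n × Euc k,
      (L : TangentSpace (𝓡 (n + k)) e →L[ℝ] Euc n × Euc k) = c.dTotal e :=
  ⟨c.mdiff_total.mfderiv he, rfl⟩

lemma exists_dBase_equiv {x : M} (hx : x ∈ c.base.source) :
    ∃ L : TangentSpace (𝓡 n) x ≃L[ℝ] Euc n,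
      (L : TangentSpace (𝓡 n) x →L[ℝ] Euc n) = c.dBase x :=
  ⟨c.mdiff_base.mfderiv hx, rfl⟩

lemma dTotal_inverse {e : E} (he : e ∈ c.total.source) (v : Euc n × Euc k) :
    c.dTotal e ((c.dTotal e).inverse v) = v := by
  obtain ⟨L, hL⟩ := c.exists_dTotal_equiv he
  rw [← hL]; simp

lemma inverse_dTotal {e : E} (he : e ∈ c.total.source) (v : TangentSpace (𝓡 (n + k)) e) :
    (c.dTotal e).inverse (c.dTotal e v) = v := by
  obtain ⟨L, hL⟩ := c.exists_dTotal_equiv he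
  rw [← hL]; simp

lemma dBase_inverse {x : M} (hx : x ∈ c.base.source) (v : Euc n) :
    c.dBase x ((c.dBase x).inverse v) = v := by
  obtain ⟨L, hL⟩ := c.exists_dBase_equiv hx
  rw [← hL]; simp

lemma inverse_dBase {x : M} (hx : x ∈ c.base.source) (v : TangentSpace (𝓡 n) x) :
    (c.dBase x).inverse (c.dBase x v) = v := by
  obtain ⟨L, hL⟩ := c.exists_dBase_equiv hx
  rw [← hL]; simp

lemma dBase_tangentMap {e : E} (he : e ∈ c.total.source) (v : TangentSpace (𝓡 (n + k)) e) :
    c.dBase (π.proj e) (π.tangentMap e v) = (c.dTotal e v).1 := by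
  have hπ : MDifferentiableAt (𝓡 (n + k)) (𝓡 n) π.proj e :=
    (π.contMDiff_proj e).mdifferentiableAt (by simp)
  have hb := c.mdiff_base.mdifferentiableAt (c.mapsTo_proj e he)
  have ht := c.mdiff_total.mdifferentiableAt he
  have h1 := mfderiv_comp e hb hπ
  have h2 : MDifferentiableAt 𝓘(ℝ, Euc n × Euc k) 𝓘(ℝ, Euc n) Prod.fst (c.total e) :=
    differentiableAt_fst.mdifferentiableAt
  have h3 := mfderiv_comp e h2 ht
  have h4 : (c.base ∘ π.proj) =ᶠ[𝓝 e] (Prod.fst ∘ c.total) := by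
    filter_upwards [c.total.open_source.mem_nhds he] with y hy
    exact (c.fst_total y hy).symm
  rw [h4.mfderiv_eq, h3, mfderiv_eq_fderiv, fderiv_fst] at h1
  exact (DFunLike.congr_fun h1 v).symm

lemma tangentMap_inverse {e : E} (he : e ∈ c.total.source) (v : Euc n × Euc k) :
    π.tangentMap e ((c.dTotal e).inverse v) = (c.dBase (π.proj e)).inverse v.1 := by
  rw [← c.inverse_dBase (c.mapsTo_proj e he) (π.tangentMap e ((c.dTotal e).inverse v)),
    c.dBase_tangentMap he, c.dTotal_inverse he]

/-- The change of adapted coordinates. -/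
def trans (z : Euc n × Euc k) : Euc n × Euc k := c'.total (c.total.symm z)

/-- The change of base coordinates. -/
def transBase (x : Euc n) : Euc n := c'.base (c.base.symm x)

lemma contDiffOn_trans :
    ContDiffOn ℝ ∞ (c.trans c') (c.total.symm.trans c'.total).source := by
  rw [← contMDiffOn_iff_contDiffOn]
  refine c'.contMDiffOn_total.comp (c.contMDiffOn_total_symm.mono ?_) ?_
  · intro z hz; exact hz.1
  · intro z hz; exact hz.2

lemma contDiffOn_transBase :
    ContDiffOn ℝ ∞ (c.transBase c') (c.base.symm.trans c'.base).source := by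
  rw [← contMDiffOn_iff_contDiffOn]
  refine c'.contMDiffOn_base.comp (c.contMDiffOn_base_symm.mono ?_) ?_
  · intro z hz; exact hz.1
  · intro z hz; exact hz.2

lemma dTotal_trans {e : E} (he : e ∈ c.total.source) (he' : e ∈ c'.total.source)
    (v : TangentSpace (𝓡 (n + k)) e) :
    c'.dTotal e v = fderiv ℝ (c.trans c') (c.total e) (c.dTotal e v) := by
  have hz : c.total e ∈ (c.total.symm.trans c'.total).source := by
    refine ⟨c.total.map_source he, ?_⟩
    change c.total.symm (c.total e) ∈ c'.total.source
    rwa [c.total.left_inv he]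
  have hd : DifferentiableAt ℝ (c.trans c') (c.total e) :=
    ((c.contDiffOn_trans c').contDiffAt
      ((c.total.symm.trans c'.total).open_source.mem_nhds hz)).differentiableAt (by simp)
  have h1 := mfderiv_comp e hd.mdifferentiableAt (c.mdiff_total.mdifferentiableAt he)
  have h2 : ((c.trans c') ∘ c.total) =ᶠ[𝓝 e] c'.total := by
    filter_upwards [c.total.open_source.mem_nhds he] with y hy
    simp [trans, c.total.left_inv hy]
  rw [h2.mfderiv_eq, mfderiv_eq_fderiv] at h1
  exact DFunLike.congr_fun h1 v

lemma dBase_trans {x : M} (hx : x ∈ c.base.source) (hx' : x ∈ c'.base.source)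
    (v : TangentSpace (𝓡 n) x) :
    c'.dBase x v = fderiv ℝ (c.transBase c') (c.base x) (c.dBase x v) := by
  have hz : c.base x ∈ (c.base.symm.trans c'.base).source := by
    refine ⟨c.base.map_source hx, ?_⟩
    change c.base.symm (c.base x) ∈ c'.base.source
    rwa [c.base.left_inv hx]
  have hd : DifferentiableAt ℝ (c.transBase c') (c.base x) :=
    ((c.contDiffOn_transBase c').contDiffAt
      ((c.base.symm.trans c'.base).open_source.mem_nhds hz)).differentiableAt (by simp)
  have h1 := mfderiv_comp x hd.mdifferentiableAt (c.mdiff_base.mdifferentiableAt hx)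
  have h2 : ((c.transBase c') ∘ c.base) =ᶠ[𝓝 x] c'.base := by
    filter_upwards [c.base.open_source.mem_nhds hx] with y hy
    simp [transBase, c.base.left_inv hy]
  rw [h2.mfderiv_eq, mfderiv_eq_fderiv] at h1
  exact DFunLike.congr_fun h1 v

/-! ### Jet coordinates -/

/-- The jet coordinates `(y^A_j)` of a jet, as a linear map `ℝ^n → ℝ^k`. -/
def slope (τ : JetBundle π) : Euc n →L[ℝ] Euc k :=
  (ContinuousLinearMap.snd ℝ (Euc n) (Euc k)).comp
    ((c.dTotal τ.point).comp (τ.lift.comp (c.dBase (π.proj τ.point)).inverse))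

/-- The jet at `e` with given jet coordinates. -/
def jetOf (e : E) (he : e ∈ c.total.source) (s : Euc n →L[ℝ] Euc k) : JetBundle π where
  point := e
  lift := (c.dTotal e).inverse.comp
    (((ContinuousLinearMap.id ℝ (Euc n)).prod s).comp (c.dBase (π.proj e)))
  tangentMap_comp_lift := by
    ext1 v
    have := c.tangentMap_inverse he (c.dBase (π.proj e) v, s (c.dBase (π.proj e) v))
    rw [c.inverse_dBase (c.mapsTo_proj e he)] at this
    exact this

lemma slope_jetOf (e : E) (he : e ∈ c.total.source) (s : Euc n →L[ℝ] Euc k) :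
    c.slope (c.jetOf e he s) = s := by
  ext1 v
  change (c.dTotal e ((c.dTotal e).inverse
    (c.dBase (π.proj e) ((c.dBase (π.proj e)).inverse v),
      s (c.dBase (π.proj e) ((c.dBase (π.proj e)).inverse v))))).2 = s v
  rw [c.dTotal_inverse he, c.dBase_inverse (c.mapsTo_proj e he)]

lemma jetOf_slope (τ : JetBundle π) (he : τ.point ∈ c.total.source) :
    c.jetOf τ.point he (c.slope τ) = τ := by
  obtain ⟨e, τ, hτ⟩ := τ
  change e ∈ c.total.source at he
  refine JetBundle.ext_lift ?_
  ext1 v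
  have h1 : c.dBase (π.proj e) v = (c.dTotal e (τ v)).1 := by
    rw [← c.dBase_tangentMap he]
    congr 1
    exact (DFunLike.congr_fun hτ v).symm
  have h2 : (c.dBase (π.proj e) v, (c.dTotal e (τ v)).2) = c.dTotal e (τ v) := by
    rw [h1]
  have h3 := c.inverse_dTotal he (τ v)
  rw [← h2] at h3
  change (c.dTotal e).inverse (c.dBase (π.proj e) v,
    (c.dTotal e (τ ((c.dBase (π.proj e)).inverse (c.dBase (π.proj e) v)))).2) = τ v
  rw [c.inverse_dBase (c.mapsTo_proj e he)]
  exact h3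

/-- The jet coordinate `y^A_j(τ_e) = dy^A(τ_e(∂/∂x^j))`. -/
def jetCoord (A : Fin k) (j : Fin n) (τ : JetBundle π) : ℝ :=
  (c.dTotal τ.point (τ.lift (c.ddxBase (π.proj τ.point) j))).2 A

lemma slope_apply (A : Fin k) (j : Fin n) (τ : JetBundle π) :
    c.slope τ (stdVec j) A = c.jetCoord A j τ := rfl

/-! ### Frame coordinates -/

/-- The coordinates of the vectors `e_i` of an adapted frame: the pairs `(v^j_i, v^A_i)`. -/
def horCoord (u : AdaptedFrame π) (i : Fin n) : Euc n × Euc k :=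
  c.dTotal u.point (u.basis (Sum.inl i))

/-- The coordinates of the vectors `e_A` of an adapted frame: the vectors `(v^B_A)`; the components
`v^i_A` vanish. -/
def verCoord (u : AdaptedFrame π) (A : Fin k) : Euc k :=
  (c.dTotal u.point (u.basis (Sum.inr A))).2

/-- The Lagrangian coordinate `u^A_j = v^A_i π^i_j` (summed over `i`), where `v^A_i = dy^A(e_i)`
and `π^i_j = e^i(∂/∂x^j)`, with `(e^i, e^A)` the dual frame of `(e_i, e_A)`. -/
def lagrangianCoord (A : Fin k) (j : Fin n) (u : AdaptedFrame π) : ℝ :=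
  ∑ i : Fin n, (c.dTotal u.point (u.basis (Sum.inl i))).2 A *
    u.basis.coord (Sum.inl i) (c.ddxTotal u.point j)

/-- The family of `n + k` vectors of `ℝ^n × ℝ^k` with vertical last `k` members. -/
def family (w : Fin n → Euc n × Euc k) (v : Fin k → Euc k) : Fin n ⊕ Fin k → Euc n × Euc k :=
  Sum.elim w (fun A => (0, v A))

lemma finrank_total_eq : Fintype.card (Fin n ⊕ Fin k) = Module.finrank ℝ (Euc n × Euc k) := by
  simp

/-- The basis of `T_e E` with given frame coordinates. -/
def basisOf (e : E) (he : e ∈ c.total.source) (w : Fin n → Euc n × Euc k) (v : Fin k → Euc k)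
    (h : LinearIndependent ℝ (family w v)) :
    Module.Basis (Fin n ⊕ Fin k) ℝ (TangentSpace (𝓡 (n + k)) e) :=
  (Module.Basis.mk h (h.span_eq_top_of_card_eq_finrank' finrank_total_eq).ge).map
    (c.exists_dTotal_equiv he).choose.symm.toLinearEquiv

lemma basisOf_apply (e : E) (he : e ∈ c.total.source) (w : Fin n → Euc n × Euc k)
    (v : Fin k → Euc k) (h : LinearIndependent ℝ (family w v)) (i : Fin n ⊕ Fin k) :
    c.basisOf e he w v h i = (c.dTotal e).inverse (family w v i) := by
  have hL := (c.exists_dTotal_equiv he).choose_spec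
  rw [← hL]
  simp [basisOf]

/-- The adapted frame at `e` with given frame coordinates. -/
def frameOf (e : E) (he : e ∈ c.total.source) (w : Fin n → Euc n × Euc k) (v : Fin k → Euc k)
    (h : LinearIndependent ℝ (family w v)) : AdaptedFrame π where
  point := e
  basis := c.basisOf e he w v h
  vertical := by
    intro A
    rw [c.basisOf_apply, c.tangentMap_inverse he]
    simp [family]

lemma dTotal_basisOf (e : E) (he : e ∈ c.total.source) (w : Fin n → Euc n × Euc k)
    (v : Fin k → Euc k) (h : LinearIndependent ℝ (family w v)) (i : Fin n ⊕ Fin k) :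
    c.dTotal e (c.basisOf e he w v h i) = family w v i := by
  rw [c.basisOf_apply, c.dTotal_inverse he]

lemma family_coord (u : AdaptedFrame π) (he : u.point ∈ c.total.source) (i : Fin n ⊕ Fin k) :
    family (c.horCoord u) (c.verCoord u) i = c.dTotal u.point (u.basis i) := by
  cases i with
  | inl i => rfl
  | inr A =>
    have h := c.dBase_tangentMap he (u.basis (Sum.inr A))
    rw [u.vertical, map_zero] at h
    exact Prod.ext h rfl

lemma linearIndependent_coord (u : AdaptedFrame π) (he : u.point ∈ c.total.source) :
    LinearIndependent ℝ (family (c.horCoord u) (c.verCoord u)) := by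
  obtain ⟨L, hL⟩ := c.exists_dTotal_equiv he
  have h : family (c.horCoord u) (c.verCoord u) = fun i => L (u.basis i) := by
    funext i
    rw [c.family_coord u he, ← hL]; rfl
  rw [h]
  exact u.basis.linearIndependent.map' L.toLinearEquiv.toLinearMap (LinearEquiv.ker _)

lemma frameOf_coord (u : AdaptedFrame π) (he : u.point ∈ c.total.source) :
    c.frameOf u.point he _ _ (c.linearIndependent_coord u he) = u := by
  have h : ∀ i, c.basisOf u.point he _ _ (c.linearIndependent_coord u he) i = u.basis i := by
    intro i
    rw [c.basisOf_apply, c.family_coord u he, c.inverse_dTotal he]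
  obtain ⟨e, b, hb⟩ := u
  exact AdaptedFrame.ext_basis h

end AdaptedChart

/-! ### The smooth structures of `J¹π` and `L_π E` -/

section Smooth

set_option linter.unusedSectionVars false

variable [IsManifold (𝓡 k) ∞ F] [IsManifold (𝓡 n) ∞ M] (π : SmoothFiberBundle n k F E M)

/-- Some adapted chart around `e`. -/
def adaptedChartAt (e : E) : AdaptedChart π := (π.exists_adaptedChart e).choose

lemma mem_adaptedChartAt (e : E) : e ∈ (adaptedChartAt π e).total.source :=
  (π.exists_adaptedChart e).choose_spec

/-- The model space of `J¹π`, with coordinates `(x^i, y^A, y^A_j)`. -/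
abbrev JetModel (n k : ℕ) := (Euc n × Euc k) × (Euc n →L[ℝ] Euc k)

/-- The model space of `L_π E`, with coordinates `(x^i, y^A, v^i_j, v^A_j, v^A_B)`. -/
abbrev FrameModel (n k : ℕ) :=
  (Euc n × Euc k) × (Fin n → Euc n × Euc k) × (Fin k → Euc k)

variable {π}

open Classical in
/-- The standard jet coordinates `(x^i, y^A, y^A_j)` on `J¹π` induced by adapted coordinates. -/
def jetChart (c : AdaptedChart π) : PartialEquiv (JetBundle π) (JetModel n k) where
  toFun τ := (c.total τ.point, c.slope τ)
  invFun q := if h : q.1 ∈ c.total.target then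
      c.jetOf (c.total.symm q.1) (c.total.map_target h) q.2
    else (adaptedChartAt π (c.total.symm q.1)).jetOf _ (mem_adaptedChartAt π _) 0
  source := {τ | τ.point ∈ c.total.source}
  target := c.total.target ×ˢ univ
  map_source' τ hτ := ⟨c.total.map_source hτ, mem_univ _⟩
  map_target' q hq := by
    rw [dif_pos hq.1]; exact c.total.map_target hq.1
  left_inv' τ hτ := by
    have h1 : c.total τ.point ∈ c.total.target := c.total.map_source hτ
    rw [dif_pos h1]
    have h2 : ∀ (e : E) (he : e ∈ c.total.source), e = τ.point →
        c.jetOf e he (c.slope τ) = τ := by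
      rintro e he rfl
      exact c.jetOf_slope τ he
    exact h2 _ _ (c.total.left_inv hτ)
  right_inv' q hq := by
    rw [dif_pos hq.1]
    exact Prod.ext (c.total.right_inv hq.1) (c.slope_jetOf _ _ _)

lemma linearIndependent_std :
    LinearIndependent ℝ (AdaptedChart.family (n := n) (k := k)
      (fun i => (stdVec i, 0)) (fun A => stdVec A)) := by
  let b := (EuclideanSpace.basisFun (Fin n) ℝ).toBasis.prod
    (EuclideanSpace.basisFun (Fin k) ℝ).toBasis
  have h : AdaptedChart.family (n := n) (k := k)
      (fun i => (stdVec i, 0)) (fun A => stdVec A) = b := by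
    funext i
    cases i <;> simp [AdaptedChart.family, b]
  rw [h]
  exact b.linearIndependent

open Classical in
/-- The frame coordinates `(x^i, y^A, v^i_j, v^A_j, v^A_B)` on `L_π E` induced by adapted
coordinates. -/
def frameChart (c : AdaptedChart π) : PartialEquiv (AdaptedFrame π) (FrameModel n k) where
  toFun u := (c.total u.point, c.horCoord u, c.verCoord u)
  invFun q := if h : q.1 ∈ c.total.target ∧
        LinearIndependent ℝ (AdaptedChart.family q.2.1 q.2.2) then
      c.frameOf (c.total.symm q.1) (c.total.map_target h.1) q.2.1 q.2.2 h.2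
    else (adaptedChartAt π (c.total.symm q.1)).frameOf _ (mem_adaptedChartAt π _) _ _
      linearIndependent_std
  source := {u | u.point ∈ c.total.source}
  target := {q | q.1 ∈ c.total.target ∧ LinearIndependent ℝ (AdaptedChart.family q.2.1 q.2.2)}
  map_source' u hu := ⟨c.total.map_source hu, c.linearIndependent_coord u hu⟩
  map_target' q hq := by
    have hq : _ ∧ _ := hq
    rw [dif_pos hq]; exact c.total.map_target hq.1
  left_inv' u hu := by
    have h1 : c.total u.point ∈ c.total.target ∧
        LinearIndependent ℝ (AdaptedChart.family (c.horCoord u) (c.verCoord u)) :=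
      ⟨c.total.map_source hu, c.linearIndependent_coord u hu⟩
    rw [dif_pos h1]
    have h2 : ∀ (e : E) (he : e ∈ c.total.source), e = u.point →
        c.frameOf e he _ _ (c.linearIndependent_coord u hu) = u := by
      rintro e he rfl
      exact c.frameOf_coord u he
    exact h2 _ _ (c.total.left_inv hu)
  right_inv' q hq := by
    have hq : _ ∧ _ := hq
    rw [dif_pos hq]
    refine Prod.ext (c.total.right_inv hq.1) (Prod.ext ?_ ?_)
    · funext i
      exact c.dTotal_basisOf _ (c.total.map_target hq.1) _ _ hq.2 (Sum.inl i)
    · funext A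
      exact congrArg Prod.snd
        (c.dTotal_basisOf _ (c.total.map_target hq.1) _ _ hq.2 (Sum.inr A))

lemma jetChart_symm_point (c : AdaptedChart π) (q : JetModel n k) :
    ((jetChart c).symm q).point = c.total.symm q.1 := by
  by_cases h : q.1 ∈ c.total.target
  · exact congrArg JetBundle.point (dif_pos h)
  · exact congrArg JetBundle.point (dif_neg h)

lemma frameChart_symm_point (c : AdaptedChart π) (q : FrameModel n k) :
    ((frameChart c).symm q).point = c.total.symm q.1 := by
  by_cases h : q.1 ∈ c.total.target ∧ LinearIndependent ℝ (AdaptedChart.family q.2.1 q.2.2)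
  · exact congrArg AdaptedFrame.point (dif_pos h)
  · exact congrArg AdaptedFrame.point (dif_neg h)

lemma jetChart_trans_source (c c' : AdaptedChart π) :
    ((jetChart c).symm.trans (jetChart c')).source =
      (c.total.symm.trans c'.total).source ×ˢ univ := by
  ext q
  change (q ∈ c.total.target ×ˢ univ ∧ ((jetChart c).symm q).point ∈ c'.total.source) ↔
    ((q.1 ∈ c.total.target ∧ c.total.symm q.1 ∈ c'.total.source) ∧ q.2 ∈ univ)
  rw [jetChart_symm_point]
  simp

lemma frameChart_trans_source (c c' : AdaptedChart π) :
    ((frameChart c).symm.trans (frameChart c')).source =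
      {q | q.1 ∈ (c.total.symm.trans c'.total).source ∧
        LinearIndependent ℝ (AdaptedChart.family q.2.1 q.2.2)} := by
  ext q
  change ((q.1 ∈ c.total.target ∧ LinearIndependent ℝ (AdaptedChart.family q.2.1 q.2.2)) ∧
      ((frameChart c).symm q).point ∈ c'.total.source) ↔
    ((q.1 ∈ c.total.target ∧ c.total.symm q.1 ∈ c'.total.source) ∧
      LinearIndependent ℝ (AdaptedChart.family q.2.1 q.2.2))
  rw [frameChart_symm_point]
  tauto

/-- The change of jet coordinates. -/
def jetTrans (c c' : AdaptedChart π) (q : JetModel n k) : JetModel n k :=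
  (c.trans c' q.1,
    (ContinuousLinearMap.snd ℝ (Euc n) (Euc k)).comp
      ((fderiv ℝ (c.trans c') q.1).comp
        ((ContinuousLinearMap.inl ℝ (Euc n) (Euc k) +
          (ContinuousLinearMap.inr ℝ (Euc n) (Euc k)).comp q.2).comp
            (fderiv ℝ (c'.transBase c) (c.trans c' q.1).1))))

/-- The change of frame coordinates. -/
def frameTrans (c c' : AdaptedChart π) (q : FrameModel n k) : FrameModel n k :=
  (c.trans c' q.1, (fun i => fderiv ℝ (c.trans c') q.1 (q.2.1 i)),
    (fun A => (fderiv ℝ (c.trans c') q.1 (0, q.2.2 A)).2))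

lemma jetChart_trans_eqOn (c c' : AdaptedChart π) :
    EqOn ((jetChart c).symm.trans (jetChart c')) (jetTrans c c')
      ((jetChart c).symm.trans (jetChart c')).source := by
  intro q hq
  rw [jetChart_trans_source] at hq
  have h1 : q.1 ∈ c.total.target := hq.1.1
  have h2 : c.total.symm q.1 ∈ c'.total.source := hq.1.2
  set e := c.total.symm q.1 with he
  have h3 : e ∈ c.total.source := c.total.map_target h1
  have h4 : (jetChart c).symm q = c.jetOf e h3 q.2 := dif_pos h1
  have h5 : c.total e = q.1 := c.total.right_inv h1
  change jetChart c' ((jetChart c).symm q) = _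
  rw [h4]
  refine Prod.ext rfl ?_
  ext1 v
  have hb := c.mapsTo_proj e h3
  have hb' := c'.mapsTo_proj e h2
  have h6 : c.dBase (π.proj e) ((c'.dBase (π.proj e)).inverse v) =
      fderiv ℝ (c'.transBase c) (c.trans c' q.1).1 v := by
    rw [c'.dBase_trans c hb' hb, c'.dBase_inverse hb', ← c'.fst_total e h2]
    rfl
  change (c'.dTotal e ((c.dTotal e).inverse
    (c.dBase (π.proj e) ((c'.dBase (π.proj e)).inverse v),
      q.2 (c.dBase (π.proj e) ((c'.dBase (π.proj e)).inverse v))))).2 = _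
  rw [c.dTotal_trans c' h3 h2, c.dTotal_inverse h3, h5, h6]
  simp [jetTrans, ← Prod.snd_add, ← map_add]

lemma frameChart_trans_eqOn (c c' : AdaptedChart π) :
    EqOn ((frameChart c).symm.trans (frameChart c')) (frameTrans c c')
      ((frameChart c).symm.trans (frameChart c')).source := by
  intro q hq
  rw [frameChart_trans_source] at hq
  have h1 : q.1 ∈ c.total.target := hq.1.1
  have h2 : c.total.symm q.1 ∈ c'.total.source := hq.1.2
  set e := c.total.symm q.1 with he
  have h3 : e ∈ c.total.source := c.total.map_target h1
  have h4 : (frameChart c).symm q = c.frameOf e h3 q.2.1 q.2.2 hq.2 := dif_pos ⟨h1, hq.2⟩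
  have h5 : c.total e = q.1 := c.total.right_inv h1
  have h6 : ∀ i, c'.dTotal e (c.basisOf e h3 q.2.1 q.2.2 hq.2 i) =
      fderiv ℝ (c.trans c') q.1 (AdaptedChart.family q.2.1 q.2.2 i) := by
    intro i
    rw [c.dTotal_trans c' h3 h2, h5, c.dTotal_basisOf]
  change frameChart c' ((frameChart c).symm q) = _
  rw [h4]
  refine Prod.ext rfl (Prod.ext ?_ ?_)
  · funext i; exact h6 (Sum.inl i)
  · funext A; exact congrArg Prod.snd (h6 (Sum.inr A))

lemma contDiffOn_jetTrans (c c' : AdaptedChart π) :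
    ContDiffOn ℝ ∞ (jetTrans c c') ((c.total.symm.trans c'.total).source ×ˢ univ) := by
  have hT := c.contDiffOn_trans c'
  have hT' : ContDiffOn ℝ ∞ (fderiv ℝ (c.trans c')) (c.total.symm.trans c'.total).source :=
    hT.fderiv_of_isOpen (c.total.symm.trans c'.total).open_source (by simp)
  have hB' : ContDiffOn ℝ ∞ (fderiv ℝ (c'.transBase c)) (c'.base.symm.trans c.base).source :=
    (c'.contDiffOn_transBase c).fderiv_of_isOpen (c'.base.symm.trans c.base).open_source (by simp)
  have hf : ContDiffOn ℝ ∞ (fun q : JetModel n k => q.1)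
    ((c.total.symm.trans c'.total).source ×ˢ univ) := contDiff_fst.contDiffOn
  have hm : MapsTo (fun q : JetModel n k => q.1)
      ((c.total.symm.trans c'.total).source ×ˢ univ) (c.total.symm.trans c'.total).source :=
    fun q hq => hq.1
  have h1 := hT.comp hf hm
  have h2 := hT'.comp hf hm
  have h3 : ContDiffOn ℝ ∞ (fun q : JetModel n k => fderiv ℝ (c'.transBase c) (c.trans c' q.1).1)
      ((c.total.symm.trans c'.total).source ×ˢ univ) := by
    refine hB'.comp (contDiff_fst.comp_contDiffOn h1) ?_
    rintro q ⟨⟨hq1, hq2⟩, -⟩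
    have hq2' : c.total.symm q.1 ∈ c'.total.source := hq2
    have hq3 : c.total.symm q.1 ∈ c.total.source := c.total.map_target hq1
    have h4 : (c.trans c' q.1).1 = c'.base (π.proj (c.total.symm q.1)) := c'.fst_total _ hq2'
    change (c.trans c' q.1).1 ∈ c'.base.target ∧ c'.base.symm (c.trans c' q.1).1 ∈ c.base.source
    rw [h4]
    refine ⟨c'.base.map_source (c'.mapsTo_proj _ hq2'), ?_⟩
    rw [c'.base.left_inv (c'.mapsTo_proj _ hq2')]
    exact c.mapsTo_proj _ hq3
  refine h1.prodMk (contDiffOn_const.clm_comp (h2.clm_comp ((ContDiffOn.clm_comp ?_ h3))))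
  exact contDiffOn_const.add (contDiffOn_const.clm_comp contDiff_snd.contDiffOn)

lemma contDiffOn_frameTrans (c c' : AdaptedChart π) :
    ContDiffOn ℝ ∞ (frameTrans c c') {q | q.1 ∈ (c.total.symm.trans c'.total).source ∧
        LinearIndependent ℝ (AdaptedChart.family q.2.1 q.2.2)} := by
  have hT := c.contDiffOn_trans c'
  have hT' : ContDiffOn ℝ ∞ (fderiv ℝ (c.trans c')) (c.total.symm.trans c'.total).source :=
    hT.fderiv_of_isOpen (c.total.symm.trans c'.total).open_source (by simp)
  set S : Set (FrameModel n k) := {q | q.1 ∈ (c.total.symm.trans c'.total).source ∧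
        LinearIndependent ℝ (AdaptedChart.family q.2.1 q.2.2)}
  have hf : ContDiffOn ℝ ∞ (fun q : FrameModel n k => q.1) S := contDiff_fst.contDiffOn
  have hm : MapsTo (fun q : FrameModel n k => q.1) S (c.total.symm.trans c'.total).source :=
    fun q hq => hq.1
  have h1 := hT.comp hf hm
  have h2 := hT'.comp hf hm
  refine h1.prodMk (ContDiffOn.prodMk ?_ ?_)
  · refine contDiffOn_pi.2 (fun i => h2.clm_apply ?_)
    have : ContDiff ℝ ∞ (fun q : FrameModel n k => q.2.1 i) := by fun_prop
    exact this.contDiffOn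
  · refine contDiffOn_pi.2 (fun A => contDiff_snd.comp_contDiffOn (h2.clm_apply ?_))
    have : ContDiff ℝ ∞ (fun q : FrameModel n k => ((0 : Euc n), q.2.2 A)) := by fun_prop
    exact this.contDiffOn

lemma isOpen_frameTrans_source (c c' : AdaptedChart π) :
    IsOpen {q : FrameModel n k | q.1 ∈ (c.total.symm.trans c'.total).source ∧
        LinearIndependent ℝ (AdaptedChart.family q.2.1 q.2.2)} := by
  refine ((c.total.symm.trans c'.total).open_source.preimage continuous_fst).inter ?_
  have h : Continuous (fun q : FrameModel n k => AdaptedChart.family q.2.1 q.2.2) := by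
    refine continuous_pi (fun i => ?_)
    cases i with
    | inl i => simp only [AdaptedChart.family, Sum.elim_inl]; fun_prop
    | inr A => simp only [AdaptedChart.family, Sum.elim_inr]; fun_prop
  exact (isOpen_setOfPred_linearIndependent (𝕜 := ℝ)).preimage h

variable (π)

/-- The atlas of standard jet coordinates on `J¹π`. -/
def jetCore : ChartedSpaceCore (JetModel n k) (JetBundle π) where
  atlas := range jetChart
  chartAt τ := jetChart (adaptedChartAt π τ.point)
  mem_chart_source τ := mem_adaptedChartAt π τ.point
  chart_mem_atlas τ := mem_range_self _
  open_source := by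
    rintro _ _ ⟨c, rfl⟩ ⟨c', rfl⟩
    rw [jetChart_trans_source]
    exact (c.total.symm.trans c'.total).open_source.prod isOpen_univ
  continuousOn_toFun := by
    rintro _ _ ⟨c, rfl⟩ ⟨c', rfl⟩
    refine ContinuousOn.congr ?_ (jetChart_trans_eqOn c c')
    rw [jetChart_trans_source]
    exact (contDiffOn_jetTrans c c').continuousOn

/-- The atlas of frame coordinates on `L_π E`. -/
def frameCore : ChartedSpaceCore (FrameModel n k) (AdaptedFrame π) where
  atlas := range frameChart
  chartAt u := frameChart (adaptedChartAt π u.point)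
  mem_chart_source u := mem_adaptedChartAt π u.point
  chart_mem_atlas u := mem_range_self _
  open_source := by
    rintro _ _ ⟨c, rfl⟩ ⟨c', rfl⟩
    rw [frameChart_trans_source]
    exact isOpen_frameTrans_source c c'
  continuousOn_toFun := by
    rintro _ _ ⟨c, rfl⟩ ⟨c', rfl⟩
    refine ContinuousOn.congr ?_ (frameChart_trans_eqOn c c')
    rw [frameChart_trans_source]
    exact (contDiffOn_frameTrans c c').continuousOn

instance : TopologicalSpace (JetBundle π) := (jetCore π).toTopologicalSpace
instance : ChartedSpace (JetModel n k) (JetBundle π) := (jetCore π).toChartedSpace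
instance : TopologicalSpace (AdaptedFrame π) := (frameCore π).toTopologicalSpace
instance : ChartedSpace (FrameModel n k) (AdaptedFrame π) := (frameCore π).toChartedSpace

instance : IsManifold 𝓘(ℝ, JetModel n k) ∞ (JetBundle π) := by
  refine isManifold_of_contDiffOn _ _ _ ?_
  rintro e e' he he'
  obtain ⟨_, ⟨_, rfl⟩, he⟩ := he
  obtain ⟨_, ⟨_, rfl⟩, he'⟩ := he'
  simp only [mem_iUnion] at he he'
  obtain ⟨⟨c, rfl⟩, rfl⟩ := he
  obtain ⟨⟨c', rfl⟩, rfl⟩ := he'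
  have h : ContDiffOn ℝ ∞ ((jetChart c).symm.trans (jetChart c'))
      ((jetChart c).symm.trans (jetChart c')).source := by
    refine ContDiffOn.congr ?_ (jetChart_trans_eqOn c c')
    rw [jetChart_trans_source]
    exact contDiffOn_jetTrans c c'
  exact h.mono (fun q hq => hq.1)

instance : IsManifold 𝓘(ℝ, FrameModel n k) ∞ (AdaptedFrame π) := by
  refine isManifold_of_contDiffOn _ _ _ ?_
  rintro e e' he he'
  obtain ⟨_, ⟨_, rfl⟩, he⟩ := he
  obtain ⟨_, ⟨_, rfl⟩, he'⟩ := he'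
  simp only [mem_iUnion] at he he'
  obtain ⟨⟨c, rfl⟩, rfl⟩ := he
  obtain ⟨⟨c', rfl⟩, rfl⟩ := he'
  have h : ContDiffOn ℝ ∞ ((frameChart c).symm.trans (frameChart c'))
      ((frameChart c).symm.trans (frameChart c')).source := by
    refine ContDiffOn.congr ?_ (frameChart_trans_eqOn c c')
    rw [frameChart_trans_source]
    exact contDiffOn_frameTrans c c'
  exact h.mono (fun q hq => hq.1)

/-! ### The projection `ρ : L_π E → J¹π` -/

lemma tangentMap_surjective (e : E) : Function.Surjective (π.tangentMap e) := by
  intro v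
  have he := mem_adaptedChartAt π e
  set c := adaptedChartAt π e
  refine ⟨(c.dTotal e).inverse (c.dBase (π.proj e) v, 0), ?_⟩
  rw [c.tangentMap_inverse he, c.inverse_dBase (c.mapsTo_proj e he)]

variable {π}

lemma top_le_span_proj (u : AdaptedFrame π) :
    ⊤ ≤ Submodule.span ℝ
      (range (fun i : Fin n => π.tangentMap u.point (u.basis (Sum.inl i)))) := by
  rintro v -
  obtain ⟨w, rfl⟩ := tangentMap_surjective π u.point v
  rw [← u.basis.sum_repr w, map_sum]
  refine Submodule.sum_mem _ (fun i _ => ?_)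
  rw [map_smul]
  refine Submodule.smul_mem _ _ ?_
  cases i with
  | inl i => exact Submodule.subset_span (mem_range_self i)
  | inr A => rw [u.vertical]; exact Submodule.zero_mem _

lemma card_eq_finrank_base (x : M) :
    Fintype.card (Fin n) = Module.finrank ℝ (TangentSpace (𝓡 n) x) := by
  change _ = Module.finrank ℝ (Euc n)
  simp

/-- The basis `ê_i = π_*(e)(e_i)` of `T_{π(e)} M` given by an adapted frame `(e_i, e_A)` at `e`. -/
def projBasis (u : AdaptedFrame π) :
    Module.Basis (Fin n) ℝ (TangentSpace (𝓡 n) (π.proj u.point)) :=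
  basisOfTopLeSpanOfCardEqFinrank _ (top_le_span_proj u) (card_eq_finrank_base _)

lemma projBasis_apply (u : AdaptedFrame π) (i : Fin n) :
    projBasis u i = π.tangentMap u.point (u.basis (Sum.inl i)) := by
  simp [projBasis]

/-- The projection `ρ : L_π E → J¹π`, sending an adapted frame `(e_i, e_A)` at `e` to the linear
map `T_{π(e)} M → T_e E` with `π_*(e)(e_i) ↦ e_i`. -/
def rho (u : AdaptedFrame π) : JetBundle π where
  point := u.point
  lift := LinearMap.toContinuousLinearMap
    ((projBasis u).constr ℝ (fun i => u.basis (Sum.inl i)))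
  tangentMap_comp_lift := by
    apply ContinuousLinearMap.coe_injective
    refine (projBasis u).ext (fun i => ?_)
    change π.tangentMap u.point
      ((projBasis u).constr ℝ (fun i => u.basis (Sum.inl i)) (projBasis u i)) = projBasis u i
    rw [Module.Basis.constr_basis, projBasis_apply]

end Smooth

/-! ### The right action of `GL(n) × GL(k)` on `L_π E` -/

/-- The standard basis of `ℝ^n × ℝ^k`. -/
def stdBasis (n k : ℕ) : Module.Basis (Fin n ⊕ Fin k) ℝ (Euc n × Euc k) :=
  (EuclideanSpace.basisFun (Fin n) ℝ).toBasis.prod (EuclideanSpace.basisFun (Fin k) ℝ).toBasis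

lemma stdBasis_inl (i : Fin n) : stdBasis n k (Sum.inl i) = (stdVec i, 0) := by
  simp [stdBasis]

lemma stdBasis_inr (A : Fin k) : stdBasis n k (Sum.inr A) = (0, stdVec A) := by
  simp [stdBasis]

/-- The block diagonal linear map of `ℝ^n × ℝ^k` given by `(A, B) ∈ GL(n) × GL(k)`. -/
def blockMap (g : StructureGroup n k) : (Euc n × Euc k) ≃ₗ[ℝ] Euc n × Euc k :=
  (ContinuousLinearEquiv.unitsEquiv ℝ (Euc n) g.1).toLinearEquiv.prodCongr
    (ContinuousLinearEquiv.unitsEquiv ℝ (Euc k) g.2).toLinearEquiv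

lemma blockMap_apply (g : StructureGroup n k) (v : Euc n × Euc k) :
    blockMap g v = ((g.1 : Euc n →L[ℝ] Euc n) v.1, (g.2 : Euc k →L[ℝ] Euc k) v.2) := rfl

section ChangeBasis

variable {V : Type*} [AddCommGroup V] [Module ℝ V]

/-- A frame `(e_i, e_A)` of `V` as a linear isomorphism `ℝ^n × ℝ^k → V`. -/
def frameMap (b : Module.Basis (Fin n ⊕ Fin k) ℝ V) : (Euc n × Euc k) ≃ₗ[ℝ] V :=
  (stdBasis n k).equiv b (Equiv.refl _)

lemma frameMap_stdBasis (b : Module.Basis (Fin n ⊕ Fin k) ℝ V) (i : Fin n ⊕ Fin k) :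
    frameMap b (stdBasis n k i) = b i := by
  simp [frameMap]

lemma frameMap_apply (b : Module.Basis (Fin n ⊕ Fin k) ℝ V) (v : Euc n × Euc k) :
    frameMap b v = ∑ i, v.1 i • b (Sum.inl i) + ∑ A, v.2 A • b (Sum.inr A) := by
  conv_lhs => rw [← (stdBasis n k).sum_repr v, map_sum]
  simp only [map_smul, frameMap_stdBasis, Fintype.sum_sum_type]
  simp [stdBasis]

/-- The frame `(e_i, e_A) · (A, B) = (A^i_j e_i, B^A_B e_A)`. -/
def changeBasis (b : Module.Basis (Fin n ⊕ Fin k) ℝ V) (g : StructureGroup n k) :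
    Module.Basis (Fin n ⊕ Fin k) ℝ V :=
  (stdBasis n k).map ((blockMap g).trans (frameMap b))

lemma changeBasis_inl (b : Module.Basis (Fin n ⊕ Fin k) ℝ V) (g : StructureGroup n k)
    (j : Fin n) :
    changeBasis b g (Sum.inl j) =
      ∑ i, (g.1 : Euc n →L[ℝ] Euc n) (stdVec j) i • b (Sum.inl i) := by
  simp [changeBasis, stdBasis_inl, blockMap_apply, frameMap_apply]

lemma changeBasis_inr (b : Module.Basis (Fin n ⊕ Fin k) ℝ V) (g : StructureGroup n k)
    (B : Fin k) :
    changeBasis b g (Sum.inr B) =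
      ∑ A, (g.2 : Euc k →L[ℝ] Euc k) (stdVec B) A • b (Sum.inr A) := by
  simp [changeBasis, stdBasis_inr, blockMap_apply, frameMap_apply]

lemma frameMap_changeBasis (b : Module.Basis (Fin n ⊕ Fin k) ℝ V) (g : StructureGroup n k) :
    frameMap (changeBasis b g) = (blockMap g).trans (frameMap b) := by
  refine (stdBasis n k).ext' (fun i => ?_)
  rw [frameMap_stdBasis]
  simp [changeBasis]

lemma changeBasis_one (b : Module.Basis (Fin n ⊕ Fin k) ℝ V) : changeBasis b 1 = b := by
  refine Module.Basis.eq_of_apply_eq (fun i => ?_)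
  have h : blockMap (1 : StructureGroup n k) (stdBasis n k i) = stdBasis n k i := rfl
  rw [changeBasis, Module.Basis.map_apply, LinearEquiv.trans_apply, h, frameMap_stdBasis]

lemma changeBasis_mul (b : Module.Basis (Fin n ⊕ Fin k) ℝ V) (g h : StructureGroup n k) :
    changeBasis b (g * h) = changeBasis (changeBasis b g) h := by
  refine Module.Basis.eq_of_apply_eq (fun i => ?_)
  conv_rhs => rw [changeBasis, frameMap_changeBasis]
  rfl

end ChangeBasis

namespace AdaptedFrame

variable {π : SmoothFiberBundle n k F E M}

/-- The right action `(e_i, e_A)_e · (A, B) = (A^i_j e_i, B^A_B e_A)_e`. -/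
def act (u : AdaptedFrame π) (g : StructureGroup n k) : AdaptedFrame π where
  point := u.point
  basis := changeBasis u.basis g
  vertical := by
    intro A
    simp [changeBasis_inr, u.vertical]

instance : MulAction (MulOpposite (StructureGroup n k)) (AdaptedFrame π) where
  smul g u := u.act g.unop
  one_smul u := AdaptedFrame.ext_basis (fun i => by
    rw [MulOpposite.unop_one, changeBasis_one])
  mul_smul g h u := AdaptedFrame.ext_basis (fun i => by
    rw [MulOpposite.unop_mul, changeBasis_mul]; rfl)

lemma op_smul_eq (u : AdaptedFrame π) (g : StructureGroup n k) :
    MulOpposite.op g • u = u.act g := rfl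

end AdaptedFrame

end JetFrame

end

open JetFrame

/-! In adapted coordinates an adapted frame at a point is a block triangular matrix with diagonal
blocks a = (v^i_j), b = (v^A_B) and lower left block m = (v^A_j). The vectors are independent
exactly when a and b are invertible (`isUnit_horBlock`, `isUnit_verBlock`,
`linearIndependent_glueCoord`). The condition τ_e(π_* e_i) = e_i says that the matrix y of jet
coordinates satisfies y a = m, so ρ is y = m a⁻¹ in coordinates (`jetHomeo_rho`), which is smooth
because inversion is smooth at units.

An element (g, h) of the group sends (a, m, b) to (a g, m g, b h). Thus y is unchanged, while the
pair (a, b), called `gauge`, is an H-valued function multiplied on the right by (g, h)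
(`gauge_act`). Conversely the base point, y and (a, b) determine the frame through m = y a, and all
invertible a, b occur (`glue`). Over the whole domain of an adapted chart, u ↦ (ρ(u), `gauge` u) is
therefore a smooth equivariant trivialization with smooth inverse. Freeness, the description of the
orbits and surjectivity are all read off from it.

For the Lagrangian coordinates no matrix inversion is needed: τ_e ∘ π_* is the projection w ↦ ∑
e^i(w) e_i along the vertical space (`rhoLift_tangentMap`). Evaluating it at ∂/∂x^j and applying
dy^A gives y^A_j = ∑ v^A_i π^i_j. -/

noncomputable section

namespace JetFrame

/-! ### Linear maps given by families of vectors -/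

section FamilyMap

variable {d : ℕ} {V : Type*} [NormedAddCommGroup V] [NormedSpace ℝ V]

/-- The linear map `ℝ^d → V` sending the `i`-th standard basis vector to `w i`. -/
def familyMap (w : Fin d → V) : Euc d →L[ℝ] V :=
  ∑ i, (EuclideanSpace.proj i : Euc d →L[ℝ] ℝ).smulRight (w i)

lemma familyMap_apply (w : Fin d → V) (x : Euc d) : familyMap w x = ∑ i, x i • w i := by
  simp [familyMap]

lemma familyMap_stdVec (w : Fin d → V) (j : Fin d) : familyMap w (stdVec j) = w j := by
  simp [familyMap_apply]

lemma clm_ext_stdVec {f g : Euc d →L[ℝ] V} (h : ∀ j, f (stdVec j) = g (stdVec j)) : f = g := by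
  apply ContinuousLinearMap.coe_injective
  refine (EuclideanSpace.basisFun (Fin d) ℝ).toBasis.ext (fun j => ?_)
  simpa using h j

lemma familyMap_eq (f : Euc d →L[ℝ] V) : familyMap (fun j => f (stdVec j)) = f :=
  clm_ext_stdVec (fun j => familyMap_stdVec _ j)

lemma contDiff_familyMap : ContDiff ℝ ∞ (familyMap : (Fin d → V) → (Euc d →L[ℝ] V)) := by
  unfold familyMap
  exact ContDiff.sum (fun i _ => contDiff_const.smulRight (contDiff_apply ℝ V i))

end FamilyMap

/-! ### Units of endomorphism algebras -/

section Units

variable {d : ℕ}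

open Classical in
/-- The invertible endomorphism underlying `f`, or `1` if `f` is not invertible. -/
def toGLd (f : Euc d →L[ℝ] Euc d) : GLd d := if h : IsUnit f then h.unit else 1

lemma coe_toGLd {f : Euc d →L[ℝ] Euc d} (h : IsUnit f) : (toGLd f : Euc d →L[ℝ] Euc d) = f := by
  rw [toGLd, dif_pos h, IsUnit.unit_spec]

/-- In finite dimension injectivity forces surjectivity, and a bijective continuous endomorphism is
a unit. -/
lemma isUnit_of_ker {f : Euc d →L[ℝ] Euc d} (h : ∀ x, f x = 0 → x = 0) : IsUnit f := by
  have hi : Function.Injective f := (injective_iff_map_eq_zero f).2 h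
  exact ContinuousLinearMap.isUnit_iff_bijective.2
    ⟨hi, (LinearMap.injective_iff_surjective (f := (f : Euc d →ₗ[ℝ] Euc d))).1 hi⟩

lemma GLd.inv_apply_apply (a : GLd d) (x : Euc d) :
    (↑a⁻¹ : Euc d →L[ℝ] Euc d) ((a : Euc d →L[ℝ] Euc d) x) = x :=
  DFunLike.congr_fun a.inv_mul x

lemma GLd.eq_zero_of_apply (a : GLd d) {x : Euc d} (h : (a : Euc d →L[ℝ] Euc d) x = 0) :
    x = 0 := by
  rw [← GLd.inv_apply_apply a x, h, map_zero]

/-- The inclusion of the units into the endomorphisms is an open embedding and is the chart of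
GL(d), so smoothness into GL(d) can be tested on matrix entries. Continuity of `f` need not be
assumed: `f` is recovered by composing with the smooth inverse of the embedding. -/
lemma contMDiffOn_GLd {V H N : Type*} [NormedAddCommGroup V] [NormedSpace ℝ V]
    [TopologicalSpace H] {I : ModelWithCorners ℝ V H} [TopologicalSpace N] [ChartedSpace H N]
    {f : N → GLd d} {s : Set N}
    (hf : ContMDiffOn I 𝓘(ℝ, Euc d →L[ℝ] Euc d) ∞ (fun x => (f x : Euc d →L[ℝ] Euc d)) s) :
    ContMDiffOn I 𝓘(ℝ, Euc d →L[ℝ] Euc d) ∞ f s := by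
  have he : Topology.IsOpenEmbedding (Units.val : GLd d → (Euc d →L[ℝ] Euc d)) :=
    Units.isOpenEmbedding_val
  have h1 : ContMDiffOn 𝓘(ℝ, Euc d →L[ℝ] Euc d) 𝓘(ℝ, Euc d →L[ℝ] Euc d) ∞
      (he.toOpenPartialHomeomorph Units.val).symm (range (Units.val : GLd d → _)) :=
    contMDiffOn_isOpenEmbedding_symm he
  refine (h1.comp hf (fun x _ => mem_range_self (f x))).congr (fun x _ => ?_)
  exact (he.toOpenPartialHomeomorph_left_inv).symm

end Units

/-! ### The projection and its trivializations in coordinates -/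

section Coordinates

variable {n k : ℕ}

/-- The matrix `(v^i_j)` of frame coordinates. -/
def horBlock (q : FrameModel n k) : Euc n →L[ℝ] Euc n := familyMap (fun i => (q.2.1 i).1)

/-- The matrix `(v^A_j)` of frame coordinates. -/
def mixBlock (q : FrameModel n k) : Euc n →L[ℝ] Euc k := familyMap (fun i => (q.2.1 i).2)

/-- The matrix `(v^A_B)` of frame coordinates. -/
def verBlock (q : FrameModel n k) : Euc k →L[ℝ] Euc k := familyMap q.2.2

/-- The jet coordinates of the projection of an adapted frame, in terms of its frame coordinates. -/
def rhoCoord (q : FrameModel n k) : JetModel n k :=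
  (q.1, (mixBlock q).comp (Ring.inverse (horBlock q)))

/-- The frame coordinates of the adapted frame with given projection to `J¹π` and given blocks
`(v^i_j)` and `(v^A_B)`. -/
def glueCoord (p : JetModel n k) (a : Euc n →L[ℝ] Euc n) (b : Euc k →L[ℝ] Euc k) :
    FrameModel n k :=
  (p.1, (fun i => (a (stdVec i), p.2 (a (stdVec i)))), (fun A => b (stdVec A)))

lemma contDiff_horBlock : ContDiff ℝ ∞ (horBlock : FrameModel n k → _) :=
  contDiff_familyMap.comp (contDiff_pi.2 (fun i => by fun_prop))

lemma contDiff_mixBlock : ContDiff ℝ ∞ (mixBlock : FrameModel n k → _) :=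
  contDiff_familyMap.comp (contDiff_pi.2 (fun i => by fun_prop))

lemma contDiff_verBlock : ContDiff ℝ ∞ (verBlock : FrameModel n k → _) :=
  contDiff_familyMap.comp (by fun_prop)

/-- `Ring.inverse` is a total function, smooth at units; hence the hypothesis on the point. -/
lemma contDiffAt_rhoCoord {q : FrameModel n k} (h : IsUnit (horBlock q)) :
    ContDiffAt ℝ ∞ rhoCoord q := by
  have h1 : ContDiffAt ℝ ∞ Ring.inverse (horBlock q) := contDiffAt_ringInverse ℝ h.unit
  exact contDiffAt_fst.prodMk
    (contDiff_mixBlock.contDiffAt.clm_comp (h1.comp q contDiff_horBlock.contDiffAt))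

lemma contDiff_glueCoord :
    ContDiff ℝ ∞ (fun r : JetModel n k × (Euc n →L[ℝ] Euc n) × (Euc k →L[ℝ] Euc k) =>
      glueCoord r.1 r.2.1 r.2.2) := by
  have ha : ∀ i : Fin n, ContDiff ℝ ∞
      (fun r : JetModel n k × (Euc n →L[ℝ] Euc n) × (Euc k →L[ℝ] Euc k) =>
        r.2.1 (stdVec i)) := fun i =>
    (contDiff_fst.comp contDiff_snd).clm_apply contDiff_const
  refine (contDiff_fst.comp contDiff_fst).prodMk (ContDiff.prodMk ?_ ?_)
  · exact contDiff_pi.2 (fun i =>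
      (ha i).prodMk ((contDiff_snd.comp contDiff_fst).clm_apply (ha i)))
  · exact contDiff_pi.2 (fun A => (contDiff_snd.comp contDiff_snd).clm_apply contDiff_const)

/-! ### Independence of a frame and invertibility of its diagonal blocks -/

/-- Linear combinations of the frame are products with the block triangular matrix; this turns
independence into injectivity of that matrix. -/
lemma sum_smul_family (q : FrameModel n k) (x : Euc n) (y : Euc k) :
    ∑ i, Sum.elim x y i • AdaptedChart.family q.2.1 q.2.2 i =
      (horBlock q x, mixBlock q x + verBlock q y) := by
  simp only [Fintype.sum_sum_type, Sum.elim_inl, Sum.elim_inr, AdaptedChart.family, horBlock,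
    mixBlock, verBlock, familyMap_apply]
  refine Prod.ext ?_ ?_ <;> simp [Prod.fst_sum, Prod.snd_sum]

lemma eq_zero_of_blocks {q : FrameModel n k}
    (h : LinearIndependent ℝ (AdaptedChart.family q.2.1 q.2.2)) {x : Euc n} {y : Euc k}
    (h1 : horBlock q x = 0) (h2 : mixBlock q x + verBlock q y = 0) : x = 0 ∧ y = 0 := by
  have h3 := Fintype.linearIndependent_iff.1 h (Sum.elim x y)
    (by rw [sum_smul_family, h1, h2]; rfl)
  exact ⟨by ext i; exact h3 (Sum.inl i), by ext A; exact h3 (Sum.inr A)⟩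

lemma isUnit_verBlock {q : FrameModel n k}
    (h : LinearIndependent ℝ (AdaptedChart.family q.2.1 q.2.2)) : IsUnit (verBlock q) :=
  isUnit_of_ker (fun y hy => (eq_zero_of_blocks h (x := 0) (map_zero _) (by simp [hy])).2)

/-- If a x = 0, invertibility of b allows m x to be cancelled by a vertical combination b y, giving
a linear relation among the frame vectors and so x = 0. -/
lemma isUnit_horBlock {q : FrameModel n k}
    (h : LinearIndependent ℝ (AdaptedChart.family q.2.1 q.2.2)) : IsUnit (horBlock q) := by
  refine isUnit_of_ker (fun x hx => ?_)
  obtain ⟨y, hy⟩ := (ContinuousLinearMap.isUnit_iff_bijective.1 (isUnit_verBlock h)).2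
    (-(mixBlock q x))
  exact (eq_zero_of_blocks h hx (y := y) (by rw [hy, add_neg_cancel])).1

/-! ### The change of variables (a, m, b) ↔ (y, a, b) -/

lemma horBlock_glueCoord (p : JetModel n k) (a : Euc n →L[ℝ] Euc n) (b : Euc k →L[ℝ] Euc k) :
    horBlock (glueCoord p a b) = a := familyMap_eq a

lemma verBlock_glueCoord (p : JetModel n k) (a : Euc n →L[ℝ] Euc n) (b : Euc k →L[ℝ] Euc k) :
    verBlock (glueCoord p a b) = b := familyMap_eq b

lemma mixBlock_glueCoord (p : JetModel n k) (a : Euc n →L[ℝ] Euc n) (b : Euc k →L[ℝ] Euc k) :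
    mixBlock (glueCoord p a b) = p.2.comp a := familyMap_eq (p.2.comp a)

/-- Back substitution in a block triangular system: a x = 0 gives x = 0, and then b y = 0 gives y =
0. -/
lemma linearIndependent_glueCoord (p : JetModel n k) (g : StructureGroup n k) :
    LinearIndependent ℝ (AdaptedChart.family (glueCoord p g.1 g.2).2.1
      (glueCoord p (g.1 : Euc n →L[ℝ] Euc n) (g.2 : Euc k →L[ℝ] Euc k)).2.2) := by
  refine Fintype.linearIndependent_iff.2 (fun c hc => ?_)
  set x : Euc n := WithLp.toLp 2 (fun i => c (Sum.inl i))
  set y : Euc k := WithLp.toLp 2 (fun A => c (Sum.inr A))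
  have hxy : c = Sum.elim x y := by
    funext i; cases i <;> rfl
  rw [hxy, sum_smul_family, horBlock_glueCoord, mixBlock_glueCoord, verBlock_glueCoord] at hc
  have hx : x = 0 := GLd.eq_zero_of_apply g.1 (congrArg Prod.fst hc)
  have hy : y = 0 := GLd.eq_zero_of_apply g.2 (by simpa [hx] using congrArg Prod.snd hc)
  intro i
  rw [hxy, hx, hy]
  cases i <;> rfl

lemma rhoCoord_glueCoord (p : JetModel n k) (g : StructureGroup n k) :
    rhoCoord (glueCoord p g.1 g.2) = p := by
  refine Prod.ext rfl ?_
  change (mixBlock _).comp (Ring.inverse (horBlock _)) = p.2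
  rw [horBlock_glueCoord, mixBlock_glueCoord, Ring.inverse_unit]
  ext1 x
  exact congrArg p.2 (DFunLike.congr_fun g.1.mul_inv x)

/-- Only a has to be invertible: the block m is recovered as (m a⁻¹) a. -/
lemma glueCoord_rhoCoord {q : FrameModel n k} (h : IsUnit (horBlock q)) :
    glueCoord (rhoCoord q) (horBlock q) (verBlock q) = q := by
  have h1 : ∀ x, (rhoCoord q).2 (horBlock q x) = mixBlock q x := by
    intro x
    exact congrArg (mixBlock q) (DFunLike.congr_fun (Ring.inverse_mul_cancel _ h) x)
  refine Prod.ext rfl (Prod.ext (funext fun i => ?_) (funext fun A => ?_))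
  · change (horBlock q (stdVec i), (rhoCoord q).2 (horBlock q (stdVec i))) = _
    rw [h1]
    exact Prod.ext (familyMap_stdVec _ i) (familyMap_stdVec _ i)
  · exact familyMap_stdVec _ A

end Coordinates

end JetFrame

end

noncomputable section

namespace JetFrame

section Charts

set_option linter.unusedSectionVars false

variable {n k : ℕ} {F E M : Type*}
  [TopologicalSpace F] [ChartedSpace (Euc k) F] [IsManifold (𝓡 k) ∞ F]
  [TopologicalSpace E] [ChartedSpace (Euc (n + k)) E]
  [TopologicalSpace M] [ChartedSpace (Euc n) M] [IsManifold (𝓡 n) ∞ M]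
  {π : SmoothFiberBundle n k F E M}

/-! ### Smoothness of the coordinates of `J¹π` and `L_π E` -/

/-- The jet coordinates as a chart of the manifold `J¹π`. -/
def jetHomeo (c : AdaptedChart π) : OpenPartialHomeomorph (JetBundle π) (JetModel n k) :=
  (jetCore π).openPartialHomeomorph (jetChart c) (mem_range_self c)

/-- The frame coordinates as a chart of the manifold `L_π E`. -/
def frameHomeo (c : AdaptedChart π) : OpenPartialHomeomorph (AdaptedFrame π) (FrameModel n k) :=
  (frameCore π).openPartialHomeomorph (frameChart c) (mem_range_self c)

/-- The atlas consists of the charts induced by all adapted coordinates, not only the chosen ones,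
so membership holds by construction. -/
lemma jetHomeo_mem_maximalAtlas (c : AdaptedChart π) :
    jetHomeo c ∈ IsManifold.maximalAtlas 𝓘(ℝ, JetModel n k) ∞ (JetBundle π) :=
  IsManifold.subset_maximalAtlas (mem_iUnion₂.2 ⟨_, mem_range_self c, rfl⟩)

lemma frameHomeo_mem_maximalAtlas (c : AdaptedChart π) :
    frameHomeo c ∈ IsManifold.maximalAtlas 𝓘(ℝ, FrameModel n k) ∞ (AdaptedFrame π) :=
  IsManifold.subset_maximalAtlas (mem_iUnion₂.2 ⟨_, mem_range_self c, rfl⟩)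

lemma contMDiffOn_jetHomeo (c : AdaptedChart π) :
    ContMDiffOn 𝓘(ℝ, JetModel n k) 𝓘(ℝ, JetModel n k) ∞ (jetHomeo c) (jetHomeo c).source :=
  contMDiffOn_of_mem_maximalAtlas (jetHomeo_mem_maximalAtlas c)

lemma contMDiffOn_jetHomeo_symm (c : AdaptedChart π) :
    ContMDiffOn 𝓘(ℝ, JetModel n k) 𝓘(ℝ, JetModel n k) ∞ (jetHomeo c).symm (jetHomeo c).target :=
  contMDiffOn_symm_of_mem_maximalAtlas (jetHomeo_mem_maximalAtlas c)

lemma contMDiffOn_frameHomeo (c : AdaptedChart π) :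
    ContMDiffOn 𝓘(ℝ, FrameModel n k) 𝓘(ℝ, FrameModel n k) ∞ (frameHomeo c)
      (frameHomeo c).source :=
  contMDiffOn_of_mem_maximalAtlas (frameHomeo_mem_maximalAtlas c)

lemma contMDiffOn_frameHomeo_symm (c : AdaptedChart π) :
    ContMDiffOn 𝓘(ℝ, FrameModel n k) 𝓘(ℝ, FrameModel n k) ∞ (frameHomeo c).symm
      (frameHomeo c).target :=
  contMDiffOn_symm_of_mem_maximalAtlas (frameHomeo_mem_maximalAtlas c)

lemma mem_jetHomeo_target {c : AdaptedChart π} {q : JetModel n k} :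
    q ∈ (jetHomeo c).target ↔ q.1 ∈ c.total.target :=
  ⟨fun h => h.1, fun h => ⟨h, mem_univ _⟩⟩

lemma isUnit_horBlock_frameHomeo {c : AdaptedChart π} {u : AdaptedFrame π}
    (hu : u ∈ (frameHomeo c).source) : IsUnit (horBlock (frameHomeo c u)) :=
  isUnit_horBlock ((frameHomeo c).map_source hu).2

lemma isUnit_verBlock_frameHomeo {c : AdaptedChart π} {u : AdaptedFrame π}
    (hu : u ∈ (frameHomeo c).source) : IsUnit (verBlock (frameHomeo c u)) :=
  isUnit_verBlock ((frameHomeo c).map_source hu).2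

/-! ### The projection `ρ` in coordinates -/

/-- The jet `τ_e` projected from an adapted frame at `e`, as a map between tangent spaces at `e`. -/
def rhoLift (u : AdaptedFrame π) :
    TangentSpace (𝓡 n) (π.proj u.point) →L[ℝ] TangentSpace (𝓡 (n + k)) u.point :=
  (rho u).lift

/-- This is the defining property of ρ. It is phrased with `rhoLift` so that the tangent spaces are
syntactically those at `u.point` and rewriting goes through. -/
lemma rhoLift_proj (u : AdaptedFrame π) (i : Fin n) :
    rhoLift u (π.tangentMap u.point (u.basis (Sum.inl i))) = u.basis (Sum.inl i) := by
  rw [← projBasis_apply]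
  exact (projBasis u).constr_basis ℝ (fun i => u.basis (Sum.inl i)) i

/-- The vectors π_*(e_i) form a basis of the tangent space of the base, so the defining property
determines the map. -/
lemma eq_rhoLift (u : AdaptedFrame π)
    (L : TangentSpace (𝓡 n) (π.proj u.point) →L[ℝ] TangentSpace (𝓡 (n + k)) u.point)
    (h : ∀ i, L (π.tangentMap u.point (u.basis (Sum.inl i))) = u.basis (Sum.inl i)) :
    rhoLift u = L := by
  apply ContinuousLinearMap.coe_injective
  refine (projBasis u).ext (fun i => ?_)
  change rhoLift u (projBasis u i) = L (projBasis u i)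
  rw [projBasis_apply, h, rhoLift_proj]

lemma tangentMap_eq_sum (u : AdaptedFrame π) (w : TangentSpace (𝓡 (n + k)) u.point) :
    π.tangentMap u.point w =
      ∑ i, u.basis.coord (Sum.inl i) w • π.tangentMap u.point (u.basis (Sum.inl i)) := by
  conv_lhs => rw [← u.basis.sum_repr w, map_sum]
  simp only [map_smul, Fintype.sum_sum_type, u.vertical, smul_zero, Finset.sum_const_zero,
    add_zero]
  rfl

/-- The composite τ_e ∘ π_* kills the vertical e_A and fixes each e_i: it is the projection onto the
span of the e_i along the vertical space. -/
lemma rhoLift_tangentMap (u : AdaptedFrame π) (w : TangentSpace (𝓡 (n + k)) u.point) :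
    rhoLift u (π.tangentMap u.point w) =
      ∑ i, u.basis.coord (Sum.inl i) w • u.basis (Sum.inl i) := by
  rw [tangentMap_eq_sum u w, map_sum]
  refine Finset.sum_congr rfl (fun i _ => ?_)
  rw [map_smul, rhoLift_proj]

lemma lagrangianCoord_eq (c : AdaptedChart π) (A : Fin k) (j : Fin n) (u : AdaptedFrame π)
    (hu : u.point ∈ c.total.source) : c.lagrangianCoord A j u = c.jetCoord A j (rho u) := by
  -- Since the x^i on E are pulled back from the base, ∂/∂x^j on E is projected to ∂/∂x^j on M.
  have h1 : c.ddxBase (π.proj u.point) j = π.tangentMap u.point (c.ddxTotal u.point j) :=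
    (c.tangentMap_inverse hu (stdVec j, 0)).symm
  change _ = (c.dTotal u.point (rhoLift u (c.ddxBase (π.proj u.point) j))).2 A
  rw [h1, rhoLift_tangentMap, map_sum, Prod.snd_sum]
  simp only [AdaptedChart.lagrangianCoord, map_smul]
  rw [WithLp.ofLp_sum, Finset.sum_apply]
  refine Finset.sum_congr rfl (fun i _ => ?_)
  exact mul_comm _ _

/-- In coordinates τ_e(π_* e_i) = e_i reads y^A_j v^j_i = v^A_i. -/
lemma slope_rho (c : AdaptedChart π) (u : AdaptedFrame π) (hu : u.point ∈ c.total.source)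
    (i : Fin n) : c.slope (rho u) (c.horCoord u i).1 = (c.horCoord u i).2 := by
  have h1 : (c.dBase (π.proj u.point)).inverse (c.horCoord u i).1 =
      π.tangentMap u.point (u.basis (Sum.inl i)) := by
    rw [AdaptedChart.horCoord, ← c.dBase_tangentMap hu, c.inverse_dBase (c.mapsTo_proj _ hu)]
  change (c.dTotal u.point
    (rhoLift u ((c.dBase (π.proj u.point)).inverse (c.horCoord u i).1))).2 = _
  rw [h1]
  exact congrArg (fun w => (c.dTotal u.point w).2) (rhoLift_proj u i)

/-- The relations of `slope_rho` for all i form the matrix equation y a = m, which is solved for y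
because a is invertible. -/
lemma jetHomeo_rho (c : AdaptedChart π) {u : AdaptedFrame π} (hu : u ∈ (frameHomeo c).source) :
    jetHomeo c (rho u) = rhoCoord (frameHomeo c u) := by
  refine Prod.ext rfl ?_
  have h1 : (c.slope (rho u)).comp (horBlock (frameHomeo c u)) = mixBlock (frameHomeo c u) := by
    refine clm_ext_stdVec (fun j => ?_)
    rw [ContinuousLinearMap.comp_apply, horBlock, mixBlock, familyMap_stdVec, familyMap_stdVec]
    exact slope_rho c u hu j
  change c.slope (rho u) = (mixBlock _).comp (Ring.inverse (horBlock _))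
  rw [← h1]
  ext1 x
  exact congrArg (c.slope (rho u)) (DFunLike.congr_fun
    (Ring.mul_inverse_cancel _ (isUnit_horBlock_frameHomeo hu)) x).symm

/-- Both domains are conditions on the base point in E alone, and ρ does not move it. -/
lemma rho_mem_source {c : AdaptedChart π} {u : AdaptedFrame π} :
    rho u ∈ (jetHomeo c).source ↔ u ∈ (frameHomeo c).source := Iff.rfl

lemma contMDiffOn_rho (c : AdaptedChart π) :
    ContMDiffOn 𝓘(ℝ, FrameModel n k) 𝓘(ℝ, JetModel n k) ∞ (rho : AdaptedFrame π → JetBundle π)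
      (frameHomeo c).source := by
  have h1 : ContMDiffOn 𝓘(ℝ, FrameModel n k) 𝓘(ℝ, JetModel n k) ∞
      (rhoCoord : FrameModel n k → JetModel n k) (frameHomeo c).target :=
    contMDiffOn_iff_contDiffOn.2 (fun q hq =>
      (contDiffAt_rhoCoord (isUnit_horBlock hq.2)).contDiffWithinAt)
  have h2 := (contMDiffOn_jetHomeo_symm c).comp
    (h1.comp (contMDiffOn_frameHomeo c) (fun u hu => (frameHomeo c).map_source hu))
    (fun u hu => mem_jetHomeo_target.2 (c.total.map_source hu))
  refine h2.congr (fun u hu => ?_)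
  change _ = (jetHomeo c).symm (rhoCoord (frameHomeo c u))
  rw [← jetHomeo_rho c hu]
  exact ((jetHomeo c).left_inv hu).symm

lemma contMDiff_rho : ContMDiff 𝓘(ℝ, FrameModel n k) 𝓘(ℝ, JetModel n k) ∞
    (rho : AdaptedFrame π → JetBundle π) := fun u =>
  (contMDiffOn_rho (adaptedChartAt π u.point)).contMDiffAt
    ((frameHomeo _).open_source.mem_nhds (mem_adaptedChartAt π u.point))

/-! ### The action in coordinates -/

/-- The new vectors are linear combinations of the e_i alone, so the old τ_e still lifts their
projections to them; uniqueness does the rest. -/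
lemma rho_act (u : AdaptedFrame π) (g : StructureGroup n k) : rho (u.act g) = rho u := by
  refine JetBundle.ext_lift (eq_rhoLift (u.act g) (rhoLift u) (fun j => ?_))
  change rhoLift u (π.tangentMap u.point (changeBasis u.basis g (Sum.inl j))) =
    changeBasis u.basis g (Sum.inl j)
  rw [changeBasis_inl, map_sum, map_sum]
  refine Finset.sum_congr rfl (fun i _ => ?_)
  rw [map_smul, map_smul, rhoLift_proj]

/-- The right action of the structure group in frame coordinates. -/
def actCoord (q : FrameModel n k) (a : Euc n →L[ℝ] Euc n) (b : Euc k →L[ℝ] Euc k) :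
    FrameModel n k :=
  (q.1, (fun j => familyMap q.2.1 (a (stdVec j))), fun B => familyMap q.2.2 (b (stdVec B)))

lemma contDiff_actCoord :
    ContDiff ℝ ∞ (fun r : FrameModel n k × (Euc n →L[ℝ] Euc n) × (Euc k →L[ℝ] Euc k) =>
      actCoord r.1 r.2.1 r.2.2) := by
  refine (contDiff_fst.comp contDiff_fst).prodMk (ContDiff.prodMk ?_ ?_)
  · refine contDiff_pi.2 (fun i => ContDiff.clm_apply (contDiff_familyMap.comp (by fun_prop)) ?_)
    exact (contDiff_fst.comp contDiff_snd).clm_apply contDiff_const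
  · refine contDiff_pi.2 (fun i => ContDiff.clm_apply (contDiff_familyMap.comp (by fun_prop)) ?_)
    exact (contDiff_snd.comp contDiff_snd).clm_apply contDiff_const

lemma frameHomeo_act (c : AdaptedChart π) (u : AdaptedFrame π) (g : StructureGroup n k) :
    frameHomeo c (u.act g) = actCoord (frameHomeo c u) g.1 g.2 := by
  refine Prod.ext rfl (Prod.ext (funext fun j => ?_) (funext fun B => ?_))
  · change c.dTotal u.point (changeBasis u.basis g (Sum.inl j)) = familyMap (c.horCoord u) _
    rw [changeBasis_inl, map_sum, familyMap_apply]
    simp only [map_smul]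
    rfl
  · change (c.dTotal u.point (changeBasis u.basis g (Sum.inr B))).2 = familyMap (c.verCoord u) _
    rw [changeBasis_inr, map_sum, familyMap_apply, Prod.snd_sum]
    simp only [map_smul]
    rfl

/-- Together with `verBlock_actCoord`, this is the source of equivariance: changing the frame
multiplies its diagonal blocks on the right. -/
lemma horBlock_actCoord (q : FrameModel n k) (a : Euc n →L[ℝ] Euc n) (b : Euc k →L[ℝ] Euc k) :
    horBlock (actCoord q a b) = horBlock q * a := by
  refine clm_ext_stdVec (fun j => ?_)
  change familyMap _ _ = horBlock q (a (stdVec j))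
  rw [familyMap_stdVec, horBlock, familyMap_apply]
  simp [actCoord, familyMap_apply, Prod.fst_sum]

lemma verBlock_actCoord (q : FrameModel n k) (a : Euc n →L[ℝ] Euc n) (b : Euc k →L[ℝ] Euc k) :
    verBlock (actCoord q a b) = verBlock q * b :=
  clm_ext_stdVec (fun j => familyMap_stdVec _ j)

lemma contMDiff_coe_structureGroup :
    ContMDiff (𝓘(ℝ, Euc n →L[ℝ] Euc n).prod 𝓘(ℝ, Euc k →L[ℝ] Euc k))
      𝓘(ℝ, (Euc n →L[ℝ] Euc n) × (Euc k →L[ℝ] Euc k)) ∞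
      (fun g : StructureGroup n k =>
        ((g.1 : Euc n →L[ℝ] Euc n), (g.2 : Euc k →L[ℝ] Euc k))) :=
  (Units.contMDiff_val.comp contMDiff_fst).prodMk_space (Units.contMDiff_val.comp contMDiff_snd)

lemma contMDiff_act :
    ContMDiff (𝓘(ℝ, FrameModel n k).prod (𝓘(ℝ, Euc n →L[ℝ] Euc n).prod 𝓘(ℝ, Euc k →L[ℝ] Euc k)))
      𝓘(ℝ, FrameModel n k) ∞
      (fun q : AdaptedFrame π × StructureGroup n k => MulOpposite.op q.2 • q.1) := by
  rintro ⟨u₀, g₀⟩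
  set c := adaptedChartAt π u₀.point
  -- The action fixes base points, so a single frame chart serves both the argument and the value,
  -- for every group element.
  set S : Set (AdaptedFrame π × StructureGroup n k) := Prod.fst ⁻¹' (frameHomeo c).source
  have hS : IsOpen S := (frameHomeo c).open_source.preimage continuous_fst
  have h1 : ContMDiffOn
      (𝓘(ℝ, FrameModel n k).prod (𝓘(ℝ, Euc n →L[ℝ] Euc n).prod 𝓘(ℝ, Euc k →L[ℝ] Euc k)))
      𝓘(ℝ, FrameModel n k) ∞
      (fun q : AdaptedFrame π × StructureGroup n k => frameHomeo c q.1) S :=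
    (contMDiffOn_frameHomeo c).comp contMDiff_fst.contMDiffOn (fun q hq => hq)
  have h2 := contDiff_actCoord.contMDiff.comp_contMDiffOn
    (h1.prodMk_space (contMDiff_coe_structureGroup.comp contMDiff_snd).contMDiffOn)
  have h3 : ∀ q ∈ S, q.1.act q.2 ∈ (frameHomeo c).source := fun q hq => hq
  have h4 := (contMDiffOn_frameHomeo_symm c).comp h2 (fun q hq => by
    have h5 := (frameHomeo c).map_source (h3 q hq)
    rw [frameHomeo_act] at h5
    exact h5)
  refine (h4.congr (fun q hq => ?_)).contMDiffAt (hS.mem_nhds (mem_adaptedChartAt π u₀.point))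
  change q.1.act q.2 = (frameHomeo c).symm (actCoord (frameHomeo c q.1) q.2.1 q.2.2)
  rw [← frameHomeo_act]
  exact ((frameHomeo c).left_inv (h3 q hq)).symm

/-! ### Local trivializations of `ρ` -/

/-- The blocks `((v^i_j), (v^A_B))` of an adapted frame. -/
def gauge (c : AdaptedChart π) (u : AdaptedFrame π) : StructureGroup n k :=
  (toGLd (horBlock (frameHomeo c u)), toGLd (verBlock (frameHomeo c u)))

lemma coe_gauge_fst {c : AdaptedChart π} {u : AdaptedFrame π} (hu : u ∈ (frameHomeo c).source) :
    ((gauge c u).1 : Euc n →L[ℝ] Euc n) = horBlock (frameHomeo c u) :=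
  coe_toGLd (isUnit_horBlock_frameHomeo hu)

lemma coe_gauge_snd {c : AdaptedChart π} {u : AdaptedFrame π} (hu : u ∈ (frameHomeo c).source) :
    ((gauge c u).2 : Euc k →L[ℝ] Euc k) = verBlock (frameHomeo c u) :=
  coe_toGLd (isUnit_verBlock_frameHomeo hu)

lemma gauge_act {c : AdaptedChart π} {u : AdaptedFrame π} (hu : u ∈ (frameHomeo c).source)
    (g : StructureGroup n k) : gauge c (u.act g) = gauge c u * g := by
  have hu' : u.act g ∈ (frameHomeo c).source := hu
  refine Prod.ext (Units.ext ?_) (Units.ext ?_)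
  · rw [coe_gauge_fst hu', frameHomeo_act, horBlock_actCoord, ← coe_gauge_fst hu]; rfl
  · rw [coe_gauge_snd hu', frameHomeo_act, verBlock_actCoord, ← coe_gauge_snd hu]; rfl

lemma contMDiffOn_gauge (c : AdaptedChart π) :
    ContMDiffOn 𝓘(ℝ, FrameModel n k) (𝓘(ℝ, Euc n →L[ℝ] Euc n).prod 𝓘(ℝ, Euc k →L[ℝ] Euc k)) ∞
      (gauge c) (frameHomeo c).source := by
  refine ContMDiffOn.prodMk (contMDiffOn_GLd ?_) (contMDiffOn_GLd ?_)
  · exact (contDiff_horBlock.contMDiff.comp_contMDiffOn (contMDiffOn_frameHomeo c)).congr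
      (fun u hu => coe_gauge_fst hu)
  · exact (contDiff_verBlock.contMDiff.comp_contMDiffOn (contMDiffOn_frameHomeo c)).congr
      (fun u hu => coe_gauge_snd hu)

/-- The adapted frame with given projection to `J¹π` and given blocks. -/
def glue (c : AdaptedChart π) (r : JetBundle π × StructureGroup n k) : AdaptedFrame π :=
  (frameHomeo c).symm (glueCoord (jetHomeo c r.1) r.2.1 r.2.2)

lemma glueCoord_mem_target {c : AdaptedChart π} {τ : JetBundle π} (hτ : τ ∈ (jetHomeo c).source)
    (g : StructureGroup n k) :
    glueCoord (jetHomeo c τ) g.1 g.2 ∈ (frameHomeo c).target :=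
  ⟨c.total.map_source hτ, linearIndependent_glueCoord _ g⟩

lemma glue_mem_source {c : AdaptedChart π} {τ : JetBundle π} (hτ : τ ∈ (jetHomeo c).source)
    (g : StructureGroup n k) : glue c (τ, g) ∈ (frameHomeo c).source :=
  (frameHomeo c).map_target (glueCoord_mem_target hτ g)

lemma frameHomeo_glue {c : AdaptedChart π} {τ : JetBundle π} (hτ : τ ∈ (jetHomeo c).source)
    (g : StructureGroup n k) :
    frameHomeo c (glue c (τ, g)) = glueCoord (jetHomeo c τ) g.1 g.2 :=
  (frameHomeo c).right_inv (glueCoord_mem_target hτ g)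

lemma rho_glue {c : AdaptedChart π} {τ : JetBundle π} (hτ : τ ∈ (jetHomeo c).source)
    (g : StructureGroup n k) : rho (glue c (τ, g)) = τ := by
  -- Both jets lie in the domain of one chart, so it suffices to compare their coordinates.
  refine (jetHomeo c).injOn (rho_mem_source.2 (glue_mem_source hτ g)) hτ ?_
  rw [jetHomeo_rho c (glue_mem_source hτ g), frameHomeo_glue hτ, rhoCoord_glueCoord]

lemma gauge_glue {c : AdaptedChart π} {τ : JetBundle π} (hτ : τ ∈ (jetHomeo c).source)
    (g : StructureGroup n k) : gauge c (glue c (τ, g)) = g := by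
  refine Prod.ext (Units.ext ?_) (Units.ext ?_)
  · rw [coe_gauge_fst (glue_mem_source hτ g), frameHomeo_glue hτ, horBlock_glueCoord]
  · rw [coe_gauge_snd (glue_mem_source hτ g), frameHomeo_glue hτ, verBlock_glueCoord]

lemma glue_rho_gauge {c : AdaptedChart π} {u : AdaptedFrame π}
    (hu : u ∈ (frameHomeo c).source) : glue c (rho u, gauge c u) = u := by
  rw [glue, jetHomeo_rho c hu, coe_gauge_fst hu, coe_gauge_snd hu,
    glueCoord_rhoCoord (isUnit_horBlock_frameHomeo hu)]
  exact (frameHomeo c).left_inv hu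

lemma contMDiffOn_glue (c : AdaptedChart π) :
    ContMDiffOn
      (𝓘(ℝ, JetModel n k).prod (𝓘(ℝ, Euc n →L[ℝ] Euc n).prod 𝓘(ℝ, Euc k →L[ℝ] Euc k)))
      𝓘(ℝ, FrameModel n k) ∞ (glue c) ((jetHomeo c).source ×ˢ univ) := by
  have h1 : ContMDiffOn
      (𝓘(ℝ, JetModel n k).prod (𝓘(ℝ, Euc n →L[ℝ] Euc n).prod 𝓘(ℝ, Euc k →L[ℝ] Euc k)))
      𝓘(ℝ, JetModel n k) ∞
      (fun r : JetBundle π × StructureGroup n k => jetHomeo c r.1)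
      ((jetHomeo c).source ×ˢ univ) :=
    (contMDiffOn_jetHomeo c).comp contMDiff_fst.contMDiffOn (fun r hr => hr.1)
  have h2 := contDiff_glueCoord.contMDiff.comp_contMDiffOn
    (h1.prodMk_space (contMDiff_coe_structureGroup.comp contMDiff_snd).contMDiffOn)
  exact (contMDiffOn_frameHomeo_symm c).comp h2 (fun r hr => glueCoord_mem_target hr.1 r.2)

lemma contMDiffOn_rho_gauge (c : AdaptedChart π) :
    ContMDiffOn 𝓘(ℝ, FrameModel n k)
      (𝓘(ℝ, JetModel n k).prod (𝓘(ℝ, Euc n →L[ℝ] Euc n).prod 𝓘(ℝ, Euc k →L[ℝ] Euc k))) ∞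
      (fun u : AdaptedFrame π => (rho u, gauge c u)) (frameHomeo c).source :=
  contMDiff_rho.contMDiffOn.prodMk (contMDiffOn_gauge c)

/-- The trivialization of `ρ` over the domain of the jet coordinates induced by `c`. -/
def rhoTrivialization (c : AdaptedChart π) :
    Bundle.Trivialization (StructureGroup n k) (rho : AdaptedFrame π → JetBundle π) where
  toFun u := (rho u, gauge c u)
  invFun := glue c
  source := (frameHomeo c).source
  target := (jetHomeo c).source ×ˢ univ
  map_source' _ hu := ⟨rho_mem_source.2 hu, mem_univ _⟩
  map_target' r hr := glue_mem_source hr.1 r.2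
  left_inv' _ hu := glue_rho_gauge hu
  right_inv' r hr := Prod.ext (rho_glue hr.1 r.2) (gauge_glue hr.1 r.2)
  open_source := (frameHomeo c).open_source
  open_target := (jetHomeo c).open_source.prod isOpen_univ
  continuousOn_toFun := (contMDiffOn_rho_gauge c).continuousOn
  continuousOn_invFun := (contMDiffOn_glue c).continuousOn
  baseSet := (jetHomeo c).source
  open_baseSet := (jetHomeo c).open_source
  source_eq := rfl
  target_eq := rfl
  proj_toFun _ _ := rfl

/-! ### The principal bundle structure -/

lemma eq_of_rho_eq_of_gauge_eq {c : AdaptedChart π} {u v : AdaptedFrame π}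
    (hu : u ∈ (frameHomeo c).source) (h : rho u = rho v) (hg : gauge c u = gauge c v) : u = v := by
  have hv : v ∈ (frameHomeo c).source := rho_mem_source.1 (h ▸ rho_mem_source.2 hu)
  rw [← glue_rho_gauge hu, h, hg, glue_rho_gauge hv]

lemma isSmoothPrincipalBundle_rho :
    IsSmoothPrincipalBundle 𝓘(ℝ, FrameModel n k) 𝓘(ℝ, JetModel n k)
      (𝓘(ℝ, Euc n →L[ℝ] Euc n).prod 𝓘(ℝ, Euc k →L[ℝ] Euc k))
      (StructureGroup n k) (rho : AdaptedFrame π → JetBundle π) where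
  contMDiff_act := contMDiff_act
  free u g h := by
    -- If g fixes u, then gauge(u) = gauge(u) g in the group, whence g = 1.
    have h1 := gauge_act (c := adaptedChartAt π u.point) (mem_adaptedChartAt π u.point) g
    rw [← AdaptedFrame.op_smul_eq, h] at h1
    exact (mul_eq_left.1 h1.symm)
  orbits u v := by
    constructor
    · intro h
      set c := adaptedChartAt π u.point
      have hu : u ∈ (frameHomeo c).source := mem_adaptedChartAt π u.point
      -- By equivariance this is the only candidate: it must carry gauge(u) to gauge(v).
      refine ⟨(gauge c u)⁻¹ * gauge c v, ?_⟩
      rw [AdaptedFrame.op_smul_eq]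
      refine eq_of_rho_eq_of_gauge_eq (c := c) hu ((rho_act u _).trans h) ?_
      rw [gauge_act hu, mul_inv_cancel_left]
    · rintro ⟨g, rfl⟩
      exact (rho_act u g).symm
  -- Any group element would serve in place of `1`; it only selects a point of the fiber.
  surjective τ := ⟨_, rho_glue (c := adaptedChartAt π τ.point) (mem_adaptedChartAt π τ.point) 1⟩
  contMDiff_proj := contMDiff_rho
  locally_trivial τ := by
    refine ⟨rhoTrivialization (adaptedChartAt π τ.point), mem_adaptedChartAt π τ.point,
      contMDiffOn_rho_gauge _, contMDiffOn_glue _, fun u hu g => ?_⟩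
    exact Prod.ext (rho_act u g) (gauge_act hu g)

end Charts

end JetFrame

end

open JetFrame
theorem mainTheorem2 {n k : ℕ} {F E M : Type*}
    [TopologicalSpace F] [ChartedSpace (Euc k) F] [IsManifold (𝓡 k) ∞ F]
    [TopologicalSpace E] [ChartedSpace (Euc (n + k)) E] [IsManifold (𝓡 (n + k)) ∞ E]
    [TopologicalSpace M] [ChartedSpace (Euc n) M] [IsManifold (𝓡 n) ∞ M]
    (π : SmoothFiberBundle n k F E M) :
    IsSmoothPrincipalBundle 𝓘(ℝ, FrameModel n k) 𝓘(ℝ, JetModel n k)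
      (𝓘(ℝ, Euc n →L[ℝ] Euc n).prod 𝓘(ℝ, Euc k →L[ℝ] Euc k))
      (StructureGroup n k) (rho : AdaptedFrame π → JetBundle π) ∧
    (∀ u : AdaptedFrame π,
      ∃ (τ : TangentSpace (𝓡 n) (π.proj u.point) →L[ℝ] TangentSpace (𝓡 (n + k)) u.point)
        (h : (π.tangentMap u.point).comp τ = ContinuousLinearMap.id ℝ _),
        rho u = ⟨u.point, τ, h⟩ ∧
        ∀ i : Fin n, τ (π.tangentMap u.point (u.basis (Sum.inl i))) = u.basis (Sum.inl i)) ∧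
    (∀ (c : AdaptedChart π) (A : Fin k) (j : Fin n) (u : AdaptedFrame π),
      u.point ∈ c.total.source → c.lagrangianCoord A j u = c.jetCoord A j (rho u)) := by
  refine ⟨isSmoothPrincipalBundle_rho, fun u => ?_, fun c A j u hu => lagrangianCoord_eq c A j u hu⟩
  -- The middle clause certifies that `rho` is the intended map; `rhoLift u` is its lift, so the
  -- equality of jets is definitional.
  exact ⟨rhoLift u, (rho u).tangentMap_comp_lift, rfl, rhoLift_proj u⟩
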